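/- **Setting.** Let $x_{k+1}=Ax_k+w_k$ in $\mathbb{R}^n$, $k\ge 0$, where $w_k\sim\mathcal N(0,Q)$, $Q\succeq 0$, and $x_0$ is square integrable. Active sensors $i=1,\dots,S$ ($S\ge1$) have preprocessing delays $\delta_i\in\{1,2,\dots\}$, communication delays $\delta_{c,i}\in\mathbb N$ and fusion delays $\delta_{f,i}\in\mathbb N$ (which may depend on $\delta_i$). Put $\bar\delta_i=\delta_i+\delta_{c,i}$ and $\delta_f=\sum_i\delta_{f,i}$, and label the sensors so that $\bar\delta_1\le\dots\le\bar\delta_S$. Sensor $i$ measures $z^{(i)}_k=C_ix_k+v^{(i)}_k$ with $v_k^{(i)}\sim\mathcal N(0,R_i)$, $R_i=R_i(\delta_i)\succ0$ (for instance $R_i=\frac{b_i}{\delta_i}I$, $b_i>0$), and its packet is received iff $\gamma^{(i)}_k=1$, where $\gamma_k^{(i)}\in\{0,1\}$ and $\Pr(\gamma_k^{(i)}=1)=\lambda_i\in[0,1]$. The variables $x_0$, all $w_k$, all $v^{(i)}_k$ and the arrival vectors $(\gamma^{(i)}_k)_i$, $k\ge0$, are mutually independent; $\gamma_k^{(i)}$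 and $\gamma_k^{(j)}$ are uncorrelated for $i\ne j$. At time $k$ only the received measurements $z^{(i)}_\ell$ with $0\le\ell\le k-\bar\delta_i-\delta_f$ may be used. A *constant-gain filter* has gains that do not depend on the arrival sequence: gains $K_i$, and $L_{d,i}$ for $d<\bar\delta_S$. Its estimate of $x_k$ is $\hat x_k=\hat x_{k|k-1}$, where $\hat x_{0|-1}$ is an arbitrary deterministic vector and, for $0\le t<k$, $$\hat x_{t+1|t}=A\Big(\hat x_{t|t-1}+\sum_{i:\,\bar\delta_i\le d}\gamma_t^{(i)}G_{d,i}\,(z_t^{(i)}-C_i\hat x_{t|t-1})\Big),\qquad d=k-\delta_f-t,$$ with $G_{d,i}=K_i$ if $d\ge\bar\delta_S$ and $G_{d,i}=L_{d,i}$ otherwise. Gains $(K_i)$ *have the steady state* $\Sigma$ if the mean squared error matrix of the one-step predictor $\hat x_{t+1|t}=A(\hat x_{t|t-1}+\sum_i\gamma_t^{(i)}K_i(z^{(i)}_t-C_i\hat x_{t|t-1}))$ that uses all sensors converges to $\Sigma$ for every deterministic initial estimate. Assume that some gains $(K_i)$ have a steady state (this is the assumption that the packet-loss probabilities are small enough).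 With $\Gamma_i=C_i^TR_i^{-1}C_i$ and $P\succ0$ define $$\mathcal T(P)=APA^T+Q,\quad \tilde\Gamma_d(P)=\sum_{i:\,\bar\delta_i\le d}\lambda_i\Big[\Gamma_i-(1-\lambda_i)\Gamma_i\big(P^{-1}+(1-\lambda_i)\Gamma_i\big)^{-1}\Gamma_i\Big],$$ $$\mathcal U_d(P)=\big(P^{-1}+\tilde\Gamma_d(P)\big)^{-1},\qquad \mathcal F_d=\mathcal T\circ\mathcal U_d,$$ and the multi-step iteration, for $a\ge b$, $\mathcal F^{a\to b}=\mathcal F_b\circ\mathcal F_{b+1}\circ\dots\circ\mathcal F_{a-1}$ ($a-b$ factors). The *constant-gain Kalman filter* built on $P$ has the gains $K_i=\kappa_{\bar\delta_S,i}(P)$ and $L_{d,i}=\kappa_{d,i}\big(\mathcal F^{\bar\delta_S\to d+1}(P)\big)$, where $\kappa_{d,i}(P)=\mathcal U_d(P)C_i^T\big((1-\lambda_i)C_iPC_i^T+R_i\big)^{-1}$. **Theorem.** If $(A,Q^{1/2})$ is controllable, then the algebraic Riccati equation with all active sensors, $P=\mathcal F_{\bar\delta_S}(P)$, has a positive definite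 solution. Whether or not $(A,Q^{1/2})$ is controllable, if $P_\infty\succ0$ is a solution, then it is the only positive definite one, the gains $(K_i)$ of the constant-gain Kalman filter built on $P_\infty$ have the steady state $P_\infty$, and the steady-state expected error covariance of that filter, with the expectation taken over the arrival sequence $\gamma$, exists and is, whatever the initial estimate, $$P_{\mathrm{steady}}=\lim_{k\to\infty}\mathbb E\big[\operatorname{Var}(x_k-\hat x_k\mid\gamma)\big]=\mathcal T^{\delta_{\mathrm{pred}}}\Big(\mathcal F^{\bar\delta_S\to\bar\delta_1}(P_\infty)\Big),\qquad \delta_{\mathrm{pred}}=\bar\delta_1-1+\delta_f ;$$ in particular the cost, the limit of the traces, is the trace of the right-hand side. Moreover this filter is optimal among constant-gain filters: if the gains $(K_i)$ of a constant-gain filter have a steady state and $\mathbb E[\operatorname{Var}(x_k-\hat x_k\mid\gamma)]$ converges to $\Sigma$ for that filter, then $\Sigma\succeq P_{\mathrm{steady}}$. -/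

import Mathlib

open MeasureTheory ProbabilityTheory Filter Topology Matrix

/-- The parameters of a processing network with active sensors `0, …, s` (so at least one sensor)
monitoring `x (k+1) = A x k + w k` in `ℝⁿ`.  Sensor `i` has output matrix `C i`, noise covariance
`R i d` when its preprocessing delay is `d` (for instance `(b i / d) • 1`), packets that are received
with probability `lam i`, and communication and fusion delays `comm i d`, `fus i d` that may depend on
the preprocessing delay `d`.  All delays are in time steps. -/
structure ProcessingNetwork (n s : ℕ) (m : Fin (s + 1) → ℕ) where
  A : Matrix (Fin n) (Fin n) ℝ
  Q : Matrix (Fin n) (Fin n) ℝ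
  C : ∀ i, Matrix (Fin (m i)) (Fin n) ℝ
  R : ∀ i, ℕ → Matrix (Fin (m i)) (Fin (m i)) ℝ
  lam : Fin (s + 1) → ℝ
  comm : Fin (s + 1) → ℕ → ℕ
  fus : Fin (s + 1) → ℕ → ℕ
  Q_posSemidef : Q.PosSemidef
  R_posDef : ∀ i d, 0 < d → (R i d).PosDef
  lam_mem : ∀ i, lam i ∈ Set.Icc (0 : ℝ) 1

/-- The independent sources of randomness: the initial state, the system noise at each time, the
noise of each sensor at each time, and the packet arrivals at each time. -/
inductive NoiseSource (s : ℕ) : Type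
  | initial : NoiseSource s
  | system (k : ℕ) : NoiseSource s
  | sensor (k : ℕ) (i : Fin (s + 1)) : NoiseSource s
  | arrival (k : ℕ) : NoiseSource s

/-- A constant-gain filter for the network.  Data that are `d` steps old (not counting the fusion
delay) are fused with gains that depend on neither the time nor the arrival sequence: with `steady`
if `d` is at least the largest sensor delay (all the sensors are available), with `transient d`
otherwise. -/
structure ConstantGains (n s : ℕ) (m : Fin (s + 1) → ℕ) where
  steady : ∀ i, Matrix (Fin n) (Fin (m i)) ℝ
  transient : ℕ → ∀ i, Matrix (Fin n) (Fin (m i)) ℝ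

namespace ProcessingNetwork

variable {n s : ℕ} {m : Fin (s + 1) → ℕ}

/-! ### Delays and Kalman filter operations -/

section Deterministic

variable (N : ProcessingNetwork n s m) (δ : Fin (s + 1) → ℕ)

/-- Preprocessing plus communication delay of sensor `i`. -/
def totalDelay (i : Fin (s + 1)) : ℕ := δ i + N.comm i (δ i)

/-- Total fusion delay. -/
def fusionDelay : ℕ := ∑ i, N.fus i (δ i)

/-- Sensors whose data are received within `d` steps. -/
def activeSensors (d : ℕ) : Finset (Fin (s + 1)) :=
  Finset.univ.filter fun i => N.totalDelay δ i ≤ d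

/-- `Γ i = (C i)ᵀ (R i)⁻¹ (C i)`. -/
noncomputable def sensorInfo (i : Fin (s + 1)) : Matrix (Fin n) (Fin n) ℝ :=
  (N.C i)ᵀ * (N.R i (δ i))⁻¹ * N.C i

/-- Information matrix of the data of delay `d`:
`∑ λᵢ [Γᵢ - Γᵢ (P⁻¹ / (1 - λᵢ) + Γᵢ)⁻¹ Γᵢ]`, written as
`∑ λᵢ [Γᵢ - (1 - λᵢ) Γᵢ (P⁻¹ + (1 - λᵢ) Γᵢ)⁻¹ Γᵢ]` so that it is `∑ Γᵢ` without packet loss. -/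
noncomputable def dataInfo (d : ℕ) (P : Matrix (Fin n) (Fin n) ℝ) : Matrix (Fin n) (Fin n) ℝ :=
  ∑ i ∈ N.activeSensors δ d,
    N.lam i • (N.sensorInfo δ i -
      (1 - N.lam i) •
        (N.sensorInfo δ i * (P⁻¹ + (1 - N.lam i) • N.sensorInfo δ i)⁻¹ * N.sensorInfo δ i))

/-- One-step prediction. -/
noncomputable def timeUpdate (P : Matrix (Fin n) (Fin n) ℝ) : Matrix (Fin n) (Fin n) ℝ :=
  N.A * P * N.Aᵀ + N.Q

/-- Measurement update with data of delay `d`. -/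
noncomputable def measUpdate (d : ℕ) (P : Matrix (Fin n) (Fin n) ℝ) : Matrix (Fin n) (Fin n) ℝ :=
  (P⁻¹ + N.dataInfo δ d P)⁻¹

/-- One-step Kalman filter iteration with data of delay `d`. -/
noncomputable def kfStep (d : ℕ) (P : Matrix (Fin n) (Fin n) ℝ) : Matrix (Fin n) (Fin n) ℝ :=
  N.timeUpdate (N.measUpdate δ d P)

/-- Multi-step Kalman filter iteration from delay `b + j - 1` down to delay `b` (`j` iterations,
the one with data of delay `b + j - 1` is performed first). -/
noncomputable def kfMultiStep (b : ℕ) :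
    ℕ → Matrix (Fin n) (Fin n) ℝ → Matrix (Fin n) (Fin n) ℝ
  | 0, P => P
  | j + 1, P => kfMultiStep b j (N.kfStep δ (b + j) P)

/-- The delay of the slowest sensor, when the sensors are sorted. -/
def maxDelay : ℕ := N.totalDelay δ (Fin.last s)

/-- The delay of the fastest sensor, when the sensors are sorted. -/
def minDelay : ℕ := N.totalDelay δ 0

/-- `P` is a positive definite solution of the ARE with all the sensors. -/
def IsARESolution (P : Matrix (Fin n) (Fin n) ℝ) : Prop :=
  P.PosDef ∧ P = N.kfStep δ (N.maxDelay δ) P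

/-- Length of the final multi-step prediction. -/
def predLength : ℕ := N.minDelay δ - 1 + N.fusionDelay δ

/-- Multi-step prediction applied to the multi-step Kalman filter iteration started at `P`. -/
noncomputable def predictedCov (P : Matrix (Fin n) (Fin n) ℝ) : Matrix (Fin n) (Fin n) ℝ :=
  N.timeUpdate^[N.predLength δ]
    (N.kfMultiStep δ (N.minDelay δ) (N.maxDelay δ - N.minDelay δ) P)

/-- Kalman gain of sensor `i` for the data of delay `d` when the predicted error covariance is `P`;
`(1 - λᵢ) Cᵢ P Cᵢᵀ + Rᵢ` is the noise covariance of sensor `i` inflated by packet loss. -/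
noncomputable def kalmanGain (d : ℕ) (P : Matrix (Fin n) (Fin n) ℝ) (i : Fin (s + 1)) :
    Matrix (Fin n) (Fin (m i)) ℝ :=
  N.measUpdate δ d P * (N.C i)ᵀ *
    ((1 - N.lam i) • (N.C i * P * (N.C i)ᵀ) + N.R i (δ i))⁻¹

/-- The gains of the constant-gain Kalman filter built on a predicted error covariance `P` with all
sensors: for data of delay `d` below the largest one, the predicted covariance has first gone through
the iterations with data of delays `maxDelay - 1, …, d + 1`. -/
noncomputable def kalmanGains (P : Matrix (Fin n) (Fin n) ℝ) : ConstantGains n s m where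
  steady := N.kalmanGain δ (N.maxDelay δ) P
  transient := fun d =>
    N.kalmanGain δ d (N.kfMultiStep δ (d + 1) (N.maxDelay δ - (d + 1)) P)

/-- Gain used at time `t` of the computation of the estimate of `x k`: only the data in the processed
dataset, those that sensor `i` acquired by time `k - totalDelay i - fusionDelay`, are used. -/
noncomputable def gainSchedule (G : ConstantGains n s m) (k t : ℕ) (i : Fin (s + 1)) :
    Matrix (Fin n) (Fin (m i)) ℝ :=
  if N.totalDelay δ i + N.fusionDelay δ + t ≤ k then
    if N.maxDelay δ ≤ k - N.fusionDelay δ - t then G.steady i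
    else G.transient (k - N.fusionDelay δ - t) i
  else 0

/-- Controllability of `(A, Q^{1/2})`, by the controllability Gramian. -/
def IsControllable : Prop :=
  (∑ j ∈ Finset.range n, N.A ^ j * N.Q * (N.Aᵀ) ^ j).PosDef

end Deterministic

/-! ### The stochastic model -/

/-- A realization of the network with preprocessing delays `δ` on a probability space: square
integrable initial state, Gaussian white system and sensor noises, and binary packet arrivals.  The
initial state, the noises and the arrivals at the different times are mutually independent; the
arrivals of different sensors at the same time are uncorrelated. -/
structure Realization (N : ProcessingNetwork n s m) (δ : Fin (s + 1) → ℕ)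
    {Ω : Type*} [MeasurableSpace Ω] (μ : Measure Ω) where
  x0 : Ω → Fin n → ℝ
  w : ℕ → Ω → Fin n → ℝ
  v : ℕ → ∀ i, Ω → Fin (m i) → ℝ
  γ : ℕ → Fin (s + 1) → Ω → ℝ
  x0_measurable : Measurable x0
  w_measurable : ∀ k, Measurable (w k)
  v_measurable : ∀ k i, Measurable (v k i)
  γ_measurable : ∀ k i, Measurable (γ k i)
  x0_memLp : MemLp x0 2 μ
  w_law : ∀ k, HasLaw (fun ω => WithLp.toLp 2 (w k ω)) (multivariateGaussian 0 N.Q) μ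
  v_law : ∀ k i, HasLaw (fun ω => WithLp.toLp 2 (v k i ω))
    (multivariateGaussian 0 (N.R i (δ i))) μ
  γ_binary : ∀ k i ω, γ k i ω = 0 ∨ γ k i ω = 1
  γ_prob : ∀ k i, μ.real {ω | γ k i ω = 1} = N.lam i
  γ_uncorrelated : ∀ k i j, i ≠ j → cov[γ k i, γ k j; μ] = 0
  indep : iIndep (fun a : NoiseSource s => match a with
    | .initial => MeasurableSpace.comap x0 inferInstance
    | .system k => MeasurableSpace.comap (w k) inferInstance
    | .sensor k i => MeasurableSpace.comap (v k i) inferInstance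
    | .arrival k => ⨆ i, MeasurableSpace.comap (γ k i) inferInstance) μ

namespace Realization

variable {N : ProcessingNetwork n s m} {δ : Fin (s + 1) → ℕ}
  {Ω : Type*} [MeasurableSpace Ω] {μ : Measure Ω} (X : Realization N δ μ)

/-- The state `x k`; time is counted from the initial time. -/
def state : ℕ → Ω → Fin n → ℝ
  | 0, ω => X.x0 ω
  | k + 1, ω => N.A *ᵥ state k ω + X.w k ω

/-- The measurement `z k i`. -/
def meas (k : ℕ) (i : Fin (s + 1)) (ω : Ω) : Fin (m i) → ℝ :=
  N.C i *ᵥ X.state k ω + X.v k i ω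

/-- The filter with gains `g t i` at time `t` and initial estimate `xh0`: one-step prediction of the
state at time `t`.  A measurement is used only if it is received. -/
def filterRun (g : ℕ → ∀ i, Matrix (Fin n) (Fin (m i)) ℝ) (xh0 : Fin n → ℝ) :
    ℕ → Ω → Fin n → ℝ
  | 0, _ => xh0
  | t + 1, ω => N.A *ᵥ (filterRun g xh0 t ω +
      ∑ i, X.γ t i ω • (g t i *ᵥ (X.meas t i ω - N.C i *ᵥ filterRun g xh0 t ω)))

/-- The estimate of `x k` by the constant-gain filter from the processed dataset at time `k`. -/
noncomputable def estimate (G : ConstantGains n s m) (xh0 : Fin n → ℝ) (k : ℕ) (ω : Ω) :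
    Fin n → ℝ :=
  X.filterRun (N.gainSchedule δ G k) xh0 k ω

/-- The σ-algebra generated by the whole arrival sequence. -/
@[reducible] def arrivals : MeasurableSpace Ω :=
  ⨆ k, ⨆ i, MeasurableSpace.comap (X.γ k i) inferInstance

/-- Expectation, over the arrival sequence, of the covariance matrix of a random vector `e` given the
arrival sequence. -/
noncomputable def expectedCov (e : Ω → Fin n → ℝ) : Matrix (Fin n) (Fin n) ℝ :=
  Matrix.of fun a b => ∫ ω, (μ[fun ω' =>
    (e ω' a - (μ[fun ω'' => e ω'' a | X.arrivals]) ω') *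
      (e ω' b - (μ[fun ω'' => e ω'' b | X.arrivals]) ω') | X.arrivals]) ω ∂μ

/-- `E[Var(x k - x̂ k)]` for the constant-gain filter with gains `G`. -/
noncomputable def errorCov (G : ConstantGains n s m) (xh0 : Fin n → ℝ) (k : ℕ) :
    Matrix (Fin n) (Fin n) ℝ :=
  X.expectedCov fun ω => X.state k ω - X.estimate G xh0 k ω

/-- Mean squared error matrix of the one-step predictor of `x t` that uses the constant gains `K` and
the data of all sensors acquired before time `t`. -/
noncomputable def predictorMSE (K : ∀ i, Matrix (Fin n) (Fin (m i)) ℝ) (xh0 : Fin n → ℝ) (t : ℕ) :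
    Matrix (Fin n) (Fin n) ℝ :=
  Matrix.of fun a b => ∫ ω,
    (X.state t ω a - X.filterRun (fun _ => K) xh0 t ω a) *
      (X.state t ω b - X.filterRun (fun _ => K) xh0 t ω b) ∂μ

/-- The all-sensor filter with constant gains `K` has the steady state `S`: whatever the initial
estimate, its mean squared error matrix converges to `S`. -/
def HasSteadyState (K : ∀ i, Matrix (Fin n) (Fin (m i)) ℝ) (S : Matrix (Fin n) (Fin n) ℝ) : Prop :=
  ∀ xh0 : Fin n → ℝ, Tendsto (fun t => X.predictorMSE K xh0 t) atTop (𝓝 S)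

end Realization

end ProcessingNetwork

/-!
Fix gains `K`. Since the noises and the arrivals are independent, the mean squared error of the
predictor obeys a deterministic recursion `covStep` (the Joseph form averaged over the arrivals),
which is affine and monotone, with linear part a positive map `propagate`. Completing the square
shows that `kfStep` is the minimum of `covStep` over the gains, attained at the Kalman gains; hence
`kfStep` is monotone, and comparing recursions gives optimality and uniqueness.

Existence: gains with a steady state exist, and `kfStep` lowers that steady state, so its iterates
decrease to a limit, which is a fixed point and positive definite by controllability.

Stability of the Kalman gains of a positive definite fixed point `P`: the traces of the iterates of
`P` under `propagate` decrease. If their limit is not zero, the Markov–Kakutani theorem gives a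
nonzero `Z ≥ 0` fixed by the adjoint of `propagate`. The Riccati equation then makes `Z` annihilate
the noise and the corrections, so `P * Z * P` is fixed by `propagate` for every choice of gains. For
gains that have a steady state this is impossible, because there the powers of `propagate` tend to
zero.

The initial estimate enters the error through a term determined by the arrivals. The expected
conditional covariance is therefore `covStep` iterated from the covariance of `x₀`, and the final
transient and prediction steps act continuously on the covariance of the steady phase.
-/

open scoped MatrixOrder

namespace LoewnerOrder

variable {k l : Type*}

theorem nonneg_iff_dotProduct [Fintype k] {M : Matrix k k ℝ} :
    0 ≤ M ↔ Mᵀ = M ∧ ∀ x, 0 ≤ x ⬝ᵥ M *ᵥ x := by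
  rw [Matrix.nonneg_iff_posSemidef, Matrix.posSemidef_iff_dotProduct_mulVec, Matrix.IsHermitian,
    conjTranspose_eq_transpose_of_trivial]
  simp only [star_trivial]

theorem transpose_eq_of_nonneg {M : Matrix k k ℝ} (hM : 0 ≤ M) : Mᵀ = M := by
  rw [← conjTranspose_eq_transpose_of_trivial]
  exact hM.posSemidef.isHermitian.eq

theorem posDef_of_le {M M' : Matrix k k ℝ} (hM : M.PosDef) (h : M ≤ M') : M'.PosDef := by
  simpa only [add_sub_cancel] using hM.add_posSemidef (Matrix.le_iff.1 h)

theorem posDef_mul_inv [Fintype k] [DecidableEq k] {M : Matrix k k ℝ} (hM : M.PosDef) :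
    M * M⁻¹ = 1 :=
  Matrix.mul_nonsing_inv _ ((Matrix.isUnit_iff_isUnit_det _).1 hM.isUnit)

theorem posDef_inv_mul [Fintype k] [DecidableEq k] {M : Matrix k k ℝ} (hM : M.PosDef) :
    M⁻¹ * M = 1 :=
  Matrix.nonsing_inv_mul _ ((Matrix.isUnit_iff_isUnit_det _).1 hM.isUnit)

theorem vecMulVec_nonneg [Finite k] (x : k → ℝ) : 0 ≤ vecMulVec x x := by
  simpa only [star_trivial] using (Matrix.posSemidef_vecMulVec_self_star x).nonneg

theorem conj_nonneg [Fintype k] [Finite l] {M : Matrix k k ℝ} (hM : 0 ≤ M) (B : Matrix l k ℝ) :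
    0 ≤ B * M * Bᵀ := by
  simpa only [conjTranspose_eq_transpose_of_trivial]
    using (hM.posSemidef.mul_mul_conjTranspose_same B).nonneg

theorem conj_transpose_nonneg [Fintype k] [Finite l] {M : Matrix k k ℝ} (hM : 0 ≤ M)
    (B : Matrix k l ℝ) : 0 ≤ Bᵀ * M * B := by
  simpa only [transpose_transpose] using conj_nonneg hM Bᵀ

theorem conj_mono [Fintype k] [Finite l] (B : Matrix l k ℝ) :
    Monotone fun M : Matrix k k ℝ => B * M * Bᵀ := fun M M' h => by
  simpa only [Matrix.mul_sub, Matrix.sub_mul, sub_nonneg] using conj_nonneg (sub_nonneg.2 h) B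

theorem trace_mono [Fintype k] : Monotone (Matrix.trace : Matrix k k ℝ → ℝ) := fun M M' h => by
  simpa only [Matrix.trace_sub, sub_nonneg] using (Matrix.le_iff.1 h).trace_nonneg

theorem monotone_of_map_nonneg {F : Type*} [FunLike F (Matrix k k ℝ) (Matrix l l ℝ)]
    [AddMonoidHomClass F (Matrix k k ℝ) (Matrix l l ℝ)] {L : F} (hL : ∀ M, 0 ≤ M → 0 ≤ L M) :
    Monotone L := fun M M' h => by
  simpa only [map_sub, sub_nonneg] using hL _ (sub_nonneg.2 h)

section Factorization

variable [Fintype k]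

theorem exists_eq_transpose_mul_self {M : Matrix k k ℝ} (hM : 0 ≤ M) :
    ∃ B : Matrix k k ℝ, M = Bᵀ * B := by
  classical
  obtain ⟨B, hB⟩ := CStarAlgebra.nonneg_iff_eq_star_mul_self.mp hM
  exact ⟨B, by rw [hB, star_eq_conjTranspose, conjTranspose_eq_transpose_of_trivial]⟩

theorem exists_eq_sum_vecMulVec {M : Matrix k k ℝ} (hM : 0 ≤ M) :
    ∃ x : k → k → ℝ, M = ∑ a, vecMulVec (x a) (x a) := by
  obtain ⟨B, rfl⟩ := exists_eq_transpose_mul_self hM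
  refine ⟨B, ?_⟩
  ext i j
  simp only [Matrix.mul_apply, Matrix.sum_apply, vecMulVec_apply, transpose_apply]

theorem trace_mul_nonneg {Z M : Matrix k k ℝ} (hZ : 0 ≤ Z) (hM : 0 ≤ M) : 0 ≤ (Z * M).trace := by
  obtain ⟨B, rfl⟩ := exists_eq_transpose_mul_self hM
  rw [← Matrix.mul_assoc, Matrix.trace_mul_comm, ← Matrix.mul_assoc]
  exact (conj_nonneg hZ B).posSemidef.trace_nonneg

theorem trace_mul_le_trace_mul {Z M M' : Matrix k k ℝ} (hZ : 0 ≤ Z) (h : M ≤ M') :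
    (Z * M).trace ≤ (Z * M').trace := by
  simpa only [Matrix.mul_sub, Matrix.trace_sub, sub_nonneg]
    using trace_mul_nonneg hZ (sub_nonneg.2 h)

theorem mul_mul_eq_zero_of_trace_eq_zero [Fintype l] {Z : Matrix k k ℝ} {B : Matrix k l ℝ}
    {M : Matrix l l ℝ} (hZ : 0 ≤ Z) (hM : 0 ≤ M) (h : (Z * (B * M * Bᵀ)).trace = 0) :
    Z * B * M = 0 := by
  obtain ⟨Y, rfl⟩ := exists_eq_transpose_mul_self hZ
  obtain ⟨T, rfl⟩ := exists_eq_transpose_mul_self hM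
  have hYT : Y * B * Tᵀ = 0 := by
    rw [← Matrix.trace_mul_conjTranspose_self_eq_zero_iff, conjTranspose_eq_transpose_of_trivial,
      ← h, Matrix.mul_assoc Yᵀ, Matrix.trace_mul_comm Yᵀ]
    simp only [Matrix.transpose_mul, Matrix.transpose_transpose, Matrix.mul_assoc]
  calc Yᵀ * Y * B * (Tᵀ * T) = Yᵀ * (Y * B * Tᵀ) * T := by simp only [Matrix.mul_assoc]
    _ = 0 := by rw [hYT, Matrix.mul_zero, Matrix.zero_mul]

theorem mul_eq_zero_of_trace_eq_zero {Z M : Matrix k k ℝ} (hZ : 0 ≤ Z) (hM : 0 ≤ M)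
    (h : (Z * M).trace = 0) : Z * M = 0 := by
  classical
  simpa using mul_mul_eq_zero_of_trace_eq_zero (B := 1) hZ hM (by simpa using h)

theorem posDef_of_trace_mul_eq_zero {M : Matrix k k ℝ} (hM : 0 ≤ M)
    (h : ∀ Z, 0 ≤ Z → (Z * M).trace = 0 → Z = 0) : M.PosDef := by
  refine Matrix.PosDef.of_dotProduct_mulVec_pos hM.posSemidef.isHermitian fun x hx => ?_
  refine lt_of_le_of_ne (hM.posSemidef.dotProduct_mulVec_nonneg x) fun h0 => hx ?_
  have hZ := h (vecMulVec x x) (vecMulVec_nonneg x) (by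
    rw [vecMulVec_mul, trace_vecMulVec, dotProduct_comm, ← dotProduct_mulVec, h0, star_trivial])
  funext a
  simpa only [vecMulVec_apply, Matrix.zero_apply, Pi.zero_apply, mul_self_eq_zero]
    using congrFun (congrFun hZ a) a

end Factorization

section Trace

variable [Fintype k]

theorem abs_apply_le_trace {M : Matrix k k ℝ} (hM : 0 ≤ M) (a b : k) : |M a b| ≤ M.trace := by
  obtain ⟨x, rfl⟩ := exists_eq_sum_vecMulVec hM
  rw [Matrix.sum_apply, Matrix.trace_sum]
  refine (Finset.abs_sum_le_sum_abs _ _).trans (Finset.sum_le_sum fun c _ => ?_)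
  have hsq (a) : x c a ^ 2 ≤ x c ⬝ᵥ x c := by
    rw [sq]
    exact Finset.single_le_sum (f := fun a => x c a * x c a) (fun b _ => mul_self_nonneg _)
      (Finset.mem_univ a)
  rw [vecMulVec_apply, trace_vecMulVec, abs_mul]
  nlinarith [hsq a, hsq b, sq_nonneg (|x c a| - |x c b|), sq_abs (x c a), sq_abs (x c b)]

theorem le_trace_smul_one [DecidableEq k] {M : Matrix k k ℝ} (hM : 0 ≤ M) :
    M ≤ M.trace • (1 : Matrix k k ℝ) := by
  obtain ⟨x, rfl⟩ := exists_eq_sum_vecMulVec hM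
  rw [Matrix.trace_sum, Finset.sum_smul]
  refine Finset.sum_le_sum fun a _ => sub_nonneg.1 (nonneg_iff_dotProduct.2 ⟨?_, fun y => ?_⟩)
  · simp [Matrix.transpose_sub, Matrix.transpose_vecMulVec]
  · have hCS : (x a ⬝ᵥ y) ^ 2 ≤ (x a ⬝ᵥ x a) * (y ⬝ᵥ y) := by
      simpa only [dotProduct, ← sq] using Finset.sum_mul_sq_le_sq_mul_sq Finset.univ (x a) y
    simp only [trace_vecMulVec, Matrix.sub_mulVec, Matrix.smul_mulVec, Matrix.one_mulVec,
      dotProduct_sub, dotProduct_smul, Matrix.vecMulVec_mulVec, smul_eq_mul,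
      dotProduct_comm y (x a), MulOpposite.smul_eq_mul_unop, MulOpposite.unop_op]
    linarith

end Trace

theorem exists_le_smul_of_posDef [Finite k] {P M : Matrix k k ℝ} (hP : P.PosDef) (hM : 0 ≤ M) :
    ∃ c : ℝ, 0 ≤ c ∧ M ≤ c • P := by
  classical
  have := Fintype.ofFinite k
  obtain ⟨B, rfl⟩ := exists_eq_transpose_mul_self hP.posSemidef.nonneg
  have hB : IsUnit B.det := by
    have := (Matrix.isUnit_iff_isUnit_det _).1 hP.isUnit
    rw [Matrix.det_mul] at this
    exact isUnit_of_mul_isUnit_right this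
  have hN := conj_transpose_nonneg hM B⁻¹
  refine ⟨_, hN.posSemidef.trace_nonneg, ?_⟩
  calc M = Bᵀ * ((B⁻¹)ᵀ * M * B⁻¹) * Bᵀᵀ := by
        rw [transpose_transpose, ← Matrix.mul_assoc, ← Matrix.mul_assoc, ← Matrix.transpose_mul,
          Matrix.nonsing_inv_mul _ hB, Matrix.transpose_one, Matrix.one_mul, Matrix.mul_assoc,
          Matrix.nonsing_inv_mul _ hB, Matrix.mul_one]
    _ ≤ Bᵀ * (((B⁻¹)ᵀ * M * B⁻¹).trace • 1) * Bᵀᵀ := conj_mono Bᵀ (le_trace_smul_one hN)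
    _ = ((B⁻¹)ᵀ * M * B⁻¹).trace • (Bᵀ * B) := by
        rw [transpose_transpose, Matrix.mul_smul, Matrix.mul_one, Matrix.smul_mul]

section Limits

theorem isClosed_setOf_nonneg [Finite k] : IsClosed {M : Matrix k k ℝ | 0 ≤ M} := by
  have := Fintype.ofFinite k
  simp only [nonneg_iff_dotProduct, Set.ofPred_and, Set.ofPred_forall]
  refine (isClosed_eq (by fun_prop) continuous_id).inter (isClosed_iInter fun x => ?_)
  exact isClosed_le continuous_const (by fun_prop)

instance orderClosedTopology [Finite k] : OrderClosedTopology (Matrix k k ℝ) where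
  isClosed_le' := by
    have : Continuous fun p : Matrix k k ℝ × Matrix k k ℝ => p.2 - p.1 :=
      continuous_snd.sub continuous_fst
    simpa only [Set.preimage_ofPred_eq, sub_nonneg] using isClosed_setOf_nonneg.preimage this

theorem isCompact_setOf_nonneg_and_trace_le [Fintype k] (c : ℝ) :
    IsCompact {M : Matrix k k ℝ | 0 ≤ M ∧ M.trace ≤ c} := by
  have hbox : IsCompact (X := Matrix k k ℝ)
      (Set.univ.pi fun _ => Set.univ.pi fun _ => Set.Icc (-c) c) :=
    isCompact_univ_pi (X := fun _ : k => k → ℝ) fun _ => isCompact_univ_pi fun _ => isCompact_Icc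
  refine hbox.of_isClosed_subset ?_ fun M hM a _ b _ =>
    abs_le.1 ((abs_apply_le_trace hM.1 a b).trans hM.2)
  exact isClosed_setOf_nonneg.inter (isClosed_le continuous_id.matrix_trace continuous_const)

theorem tendsto_matrix_iff {ι p q : Type*} {f : Filter ι} {M : ι → Matrix p q ℝ}
    {L : Matrix p q ℝ} :
    Tendsto M f (𝓝 L) ↔ ∀ a b, Tendsto (fun t => M t a b) f (𝓝 (L a b)) :=
  tendsto_pi_nhds.trans (forall_congr' fun _ => tendsto_pi_nhds)

theorem tendsto_zero_of_trace [Fintype k] {ι : Type*} {f : Filter ι} {M : ι → Matrix k k ℝ}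
    (hM : ∀ t, 0 ≤ M t) (h : Tendsto (fun t => (M t).trace) f (𝓝 0)) : Tendsto M f (𝓝 0) :=
  tendsto_matrix_iff.2 fun a b => squeeze_zero_norm (fun t => abs_apply_le_trace (hM t) a b) h

theorem exists_tendsto_of_antitone [Finite k] {M : ℕ → Matrix k k ℝ} (hM : ∀ t, 0 ≤ M t)
    (h : Antitone M) : ∃ L, Tendsto M atTop (𝓝 L) := by
  have := Fintype.ofFinite k
  have hs := isCompact_setOf_nonneg_and_trace_le (k := k) (M 0).trace
  have hmem (t) : M t ∈ {W : Matrix k k ℝ | 0 ≤ W ∧ W.trace ≤ (M 0).trace} :=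
    ⟨hM t, trace_mono (h t.zero_le)⟩
  have hle {L} (hL : MapClusterPt L atTop M) (t) : L ≤ M t :=
    isClosed_Iic.mem_of_mapClusterPt hL ((eventually_ge_atTop t).mono fun u hu => h hu)
  have hge {L L'} (hL : MapClusterPt L atTop M) (hL' : ∀ t, L' ≤ M t) : L' ≤ L :=
    isClosed_Ici.mem_of_mapClusterPt hL (Eventually.of_forall hL')
  obtain ⟨L, -, hL⟩ := hs.exists_mapClusterPt_of_frequently (Frequently.of_forall (f := atTop) hmem)
  exact ⟨L, hs.tendsto_nhds_of_unique_mapClusterPt (Eventually.of_forall hmem) fun L' _ hL' =>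
    (hge hL (hle hL')).antisymm (hge hL' (hle hL))⟩

theorem tendsto_matrix_inv [Fintype k] [DecidableEq k] {ι : Type*} {f : Filter ι}
    {M : ι → Matrix k k ℝ} {L : Matrix k k ℝ} (hL : L.PosDef) (h : Tendsto M f (𝓝 L)) :
    Tendsto (fun t => (M t)⁻¹) f (𝓝 L⁻¹) := by
  refine (continuousAt_matrix_inv L ?_).tendsto.comp h
  rw [Ring.inverse_eq_inv']
  exact continuousAt_inv₀ hL.det_pos.ne'

end Limits

section FixedPoints

/-- **Markov–Kakutani** for a single map: a cluster point of the Birkhoff averages is fixed. -/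
theorem exists_mem_fixed_of_isCompact_of_convex {E : Type*} [AddCommGroup E] [Module ℝ E]
    [TopologicalSpace E] [IsTopologicalAddGroup E] [ContinuousSMul ℝ E] [T2Space E]
    (L : E →L[ℝ] E) {S : Set E} (hS : IsCompact S) (hconv : Convex ℝ S) (hne : S.Nonempty)
    (hLS : Set.MapsTo L S S) : ∃ x ∈ S, L x = x := by
  obtain ⟨x₀, hx₀⟩ := hne
  let b (t : ℕ) : E := birkhoffAverage ℝ L id (t + 1) x₀
  have hbS (t) : b t ∈ S := by
    simp only [b, birkhoffAverage, birkhoffSum, Finset.smul_sum]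
    refine hconv.sum_mem (fun _ _ => by positivity) ?_ fun u _ => hLS.iterate u hx₀
    simp only [Finset.sum_const, Finset.card_range, nsmul_eq_mul]
    exact mul_inv_cancel₀ (Nat.cast_ne_zero.2 t.succ_ne_zero)
  have hmove (t) : L (b t) - b t = ((t + 1 : ℕ) : ℝ)⁻¹ • (L^[t + 1] x₀ - x₀) := by
    have hL : L (b t) = birkhoffAverage ℝ L id (t + 1) (L x₀) := by
      simp only [b, birkhoffAverage, birkhoffSum, map_smul, map_sum, id_eq,
        ← Function.iterate_succ_apply, Function.iterate_succ_apply']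
    rw [hL, birkhoffAverage_apply_sub_birkhoffAverage, id_eq, id_eq]
  have hzero : Tendsto (fun t => L (b t) - b t) atTop (𝓝 0) := by
    simp only [hmove, sub_eq_add_neg]
    exact (IsCompact.isVonNBounded (𝕜 := ℝ) (hS.add hS.neg)).smul_tendsto_zero
      (Eventually.of_forall fun t => Set.add_mem_add (hLS.iterate (t + 1) hx₀)
        (Set.neg_mem_neg.2 hx₀))
      (tendsto_inv_atTop_nhds_zero_nat.comp (tendsto_add_atTop_nat 1))
  obtain ⟨x, hx, hxb⟩ :=
    hS.exists_mapClusterPt_of_frequently (Frequently.of_forall (f := atTop) hbS)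
  have hcluster : MapClusterPt (L x - x) atTop fun t => L (b t) - b t :=
    hxb.continuousAt_comp (f := fun y => L y - y) (by fun_prop)
  exact ⟨x, hx, sub_eq_zero.1 (eq_of_nhds_neBot (hcluster.neBot.mono (inf_le_inf_left _ hzero)))⟩

variable [Fintype k] {L L' : Module.End ℝ (Matrix k k ℝ)}

theorem trace_mul_pow_apply (hadj : ∀ Z M, (Z * L M).trace = (L' Z * M).trace)
    (t : ℕ) (Z M : Matrix k k ℝ) : (Z * (L ^ (t + 1)) M).trace = (L' Z * (L ^ t) M).trace := by
  rw [pow_succ', Module.End.mul_apply, hadj]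

theorem exists_fixed_of_le_trace_pow (hL' : ∀ Z, 0 ≤ Z → 0 ≤ L' Z)
    (hadj : ∀ Z M, (Z * L M).trace = (L' Z * M).trace) {P : Matrix k k ℝ} (hP : P.PosDef)
    (hLP : L P ≤ P) {ℓ : ℝ} (hℓ : ∀ t, ℓ ≤ ((L ^ t) P).trace) :
    ∃ Z, 0 ≤ Z ∧ L' Z = Z ∧ ℓ ≤ (Z * P).trace := by
  classical
  set S : Set (Matrix k k ℝ) :=
    {Z | 0 ≤ Z ∧ (Z * P).trace ≤ P.trace ∧ ∀ t, ℓ ≤ (Z * (L ^ t) P).trace} with hS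
  have hcont (M : Matrix k k ℝ) : Continuous fun Z : Matrix k k ℝ => (Z * M).trace :=
    (continuous_id.matrix_mul continuous_const).matrix_trace
  have hcompact : IsCompact S := by
    obtain ⟨c, hc, h1⟩ := exists_le_smul_of_posDef hP (M := 1) Matrix.PosSemidef.one.nonneg
    refine (isCompact_setOf_nonneg_and_trace_le (c * P.trace)).of_isClosed_subset ?_ ?_
    · simp only [hS, Set.ofPred_and, Set.ofPred_forall]
      exact isClosed_setOf_nonneg.inter ((isClosed_le (hcont P) continuous_const).inter
        (isClosed_iInter fun t => isClosed_le continuous_const (hcont _)))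
    · rintro Z ⟨hZ, hZP, -⟩
      have := trace_mul_le_trace_mul hZ h1
      rw [Matrix.mul_one, Matrix.mul_smul, Matrix.trace_smul, smul_eq_mul] at this
      exact ⟨hZ, this.trans (by gcongr)⟩
  have hconv : Convex ℝ S := by
    rintro Z ⟨hZ, hZP, hZℓ⟩ W ⟨hW, hWP, hWℓ⟩ a b ha hb hab
    have htr (M) : ((a • Z + b • W) * M).trace = a * (Z * M).trace + b * (W * M).trace := by
      simp [Matrix.add_mul]
    refine ⟨add_nonneg (smul_nonneg ha hZ) (smul_nonneg hb hW), ?_, fun t => ?_⟩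
    · rw [htr]
      exact convex_Iic (𝕜 := ℝ) P.trace (Set.mem_Iic.2 hZP) (Set.mem_Iic.2 hWP) ha hb hab
    · rw [htr]
      exact convex_Ici (𝕜 := ℝ) ℓ (Set.mem_Ici.2 (hZℓ t)) (Set.mem_Ici.2 (hWℓ t)) ha hb hab
  have hmaps : Set.MapsTo L' S S := fun Z ⟨hZ, hZP, hZℓ⟩ =>
    ⟨hL' Z hZ, hadj Z P ▸ (trace_mul_le_trace_mul hZ hLP).trans hZP,
      fun t => trace_mul_pow_apply hadj t Z P ▸ hZℓ (t + 1)⟩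
  have h1 : (1 : Matrix k k ℝ) ∈ S :=
    ⟨Matrix.PosSemidef.one.nonneg, by rw [Matrix.one_mul], fun t => by
      rw [Matrix.one_mul]; exact hℓ t⟩
  obtain ⟨Z, ⟨hZ, -, hZℓ⟩, hfix⟩ :=
    exists_mem_fixed_of_isCompact_of_convex (LinearMap.toContinuousLinearMap L') hcompact hconv
      ⟨1, h1⟩ hmaps
  exact ⟨Z, hZ, hfix, hZℓ 0⟩

theorem tendsto_pow_apply_zero (hL : ∀ M, 0 ≤ M → 0 ≤ L M) (hL' : ∀ Z, 0 ≤ Z → 0 ≤ L' Z)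
    (hadj : ∀ Z M, (Z * L M).trace = (L' Z * M).trace) {P : Matrix k k ℝ} (hP : P.PosDef)
    (hLP : L P ≤ P) (hfix : ∀ Z, 0 ≤ Z → L' Z = Z → Z * P = 0) {M : Matrix k k ℝ} (hM : 0 ≤ M) :
    Tendsto (fun t => (L ^ t) M) atTop (𝓝 0) := by
  have hpow {M : Matrix k k ℝ} (hM : 0 ≤ M) (t) : 0 ≤ (L ^ t) M := by
    induction t with
    | zero => exact hM
    | succ t ih => rw [pow_succ', Module.End.mul_apply]; exact hL _ ih
  have hanti : Antitone fun t => ((L ^ t) P).trace := trace_mono.comp_antitone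
    (by simpa only [Module.End.coe_pow]
      using (monotone_of_map_nonneg hL).antitone_iterate_of_map_le hLP)
  have hpos (t) : 0 ≤ ((L ^ t) P).trace := (hpow hP.posSemidef.nonneg t).posSemidef.trace_nonneg
  have hlim := tendsto_atTop_ciInf hanti ⟨0, Set.forall_mem_range.2 hpos⟩
  have hinf : ⨅ t, ((L ^ t) P).trace = 0 := by
    refine le_antisymm ?_ (le_ciInf hpos)
    obtain ⟨Z, hZ, hLZ, hle⟩ := exists_fixed_of_le_trace_pow hL' hadj hP hLP
      (ciInf_le ⟨0, Set.forall_mem_range.2 hpos⟩)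
    rwa [hfix Z hZ hLZ, Matrix.trace_zero] at hle
  rw [hinf] at hlim
  obtain ⟨c, -, hMc⟩ := exists_le_smul_of_posDef hP hM
  refine tendsto_zero_of_trace (hpow hM) (squeeze_zero
    (fun t => (hpow hM t).posSemidef.trace_nonneg) (fun t => ?_)
    (by simpa only [mul_zero] using hlim.const_mul c))
  have := trace_mono (sub_nonneg.1 (map_sub (L ^ t) _ _ ▸ hpow (sub_nonneg.2 hMc) t))
  rwa [map_smul, Matrix.trace_smul, smul_eq_mul] at this

end FixedPoints

section CongruenceSum

variable {ι : Type*} [Fintype ι] [Fintype k]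

/-- The positive map `M ↦ ∑ j, c j • (B j * M * (B j)ᵀ)`. -/
def congruenceSum (c : ι → ℝ) (B : ι → Matrix l k ℝ) : Matrix k k ℝ →ₗ[ℝ] Matrix l l ℝ where
  toFun M := ∑ j, c j • (B j * M * (B j)ᵀ)
  map_add' M M' := by
    simp only [Matrix.mul_add, Matrix.add_mul, smul_add, Finset.sum_add_distrib]
  map_smul' a M := by
    simp only [Matrix.mul_smul, Matrix.smul_mul, Finset.smul_sum, RingHom.id_apply,
      smul_comm a (c _)]

variable {c : ι → ℝ} {B : ι → Matrix l k ℝ}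

theorem congruenceSum_nonneg [Finite l] (hc : ∀ j, 0 ≤ c j) {M : Matrix k k ℝ} (hM : 0 ≤ M) :
    0 ≤ congruenceSum c B M :=
  have := Fintype.ofFinite l
  Finset.sum_nonneg fun j _ => smul_nonneg (hc j) (conj_nonneg hM (B j))

theorem trace_mul_congruenceSum [Fintype l] (Z : Matrix l l ℝ) (M : Matrix k k ℝ) :
    (Z * congruenceSum c B M).trace = (congruenceSum c (fun j => (B j)ᵀ) Z * M).trace := by
  simp only [congruenceSum, LinearMap.coe_mk, AddHom.coe_mk, Matrix.mul_sum, Matrix.sum_mul,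
    Matrix.trace_sum, Matrix.mul_smul, Matrix.smul_mul, Matrix.trace_smul, transpose_transpose]
  refine Finset.sum_congr rfl fun j _ => ?_
  rw [← Matrix.mul_assoc, Matrix.trace_mul_comm, ← Matrix.mul_assoc, ← Matrix.mul_assoc]

end CongruenceSum

end LoewnerOrder

namespace SecondMoment

variable {Ω : Type*} {mΩ : MeasurableSpace Ω} {k l r : Type*}

theorem measurable_mulVec [Fintype k] [Finite l] (B : Matrix l k ℝ) {e : Ω → k → ℝ}
    (he : Measurable e) : Measurable fun ω => B *ᵥ e ω := by
  have hB : Continuous fun x : k → ℝ => B *ᵥ x := by fun_prop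
  exact hB.measurable.comp he

variable {μ : Measure Ω}

theorem memLp_mulVec [Fintype k] [Fintype l] (B : Matrix l k ℝ) {e : Ω → k → ℝ}
    (he : MemLp e 2 μ) : MemLp (fun ω => B *ᵥ e ω) 2 μ :=
  B.mulVecLin.toContinuousLinearMap.comp_memLp' he

theorem memLp_binary_smul [Fintype k] {φ : Ω → ℝ} (hφ : Measurable φ)
    (hb : ∀ ω, φ ω = 0 ∨ φ ω = 1) {e : Ω → k → ℝ} (he : MemLp e 2 μ) :
    MemLp (fun ω => φ ω • e ω) 2 μ := by
  refine he.mono (hφ.aestronglyMeasurable.smul he.1) (Eventually.of_forall fun ω => ?_)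
  rcases hb ω with h | h <;> simp [h]

/-- Matrix of the mixed second moments of two random vectors. -/
noncomputable def crossMoment (μ : Measure Ω) (e : Ω → k → ℝ) (f : Ω → l → ℝ) : Matrix k l ℝ :=
  Matrix.of fun a b => ∫ ω, e ω a * f ω b ∂μ

theorem crossMoment_apply (e : Ω → k → ℝ) (f : Ω → l → ℝ) (a b) :
    crossMoment μ e f a b = ∫ ω, e ω a * f ω b ∂μ := rfl

theorem crossMoment_transpose (e : Ω → k → ℝ) (f : Ω → l → ℝ) :
    (crossMoment μ e f)ᵀ = crossMoment μ f e := by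
  ext a b
  simp only [Matrix.transpose_apply, crossMoment_apply, mul_comm]

theorem crossMoment_const_const [IsProbabilityMeasure μ] (x : k → ℝ) (y : l → ℝ) :
    crossMoment μ (fun _ => x) (fun _ => y) = vecMulVec x y := by
  ext a b
  simp [crossMoment_apply, vecMulVec_apply]

theorem crossMoment_const_right {e : Ω → k → ℝ} (he : ∀ a, ∫ ω, e ω a ∂μ = 0) (y : l → ℝ) :
    crossMoment μ e (fun _ => y) = 0 := by
  ext a b
  rw [crossMoment_apply, integral_mul_const, he, zero_mul, Matrix.zero_apply]

section Bilinear

variable [Fintype k] [Fintype l] {e e' : Ω → k → ℝ} {f f' : Ω → l → ℝ}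

theorem integrable_mul_coord (he : MemLp e 2 μ) (hf : MemLp f 2 μ) (a b) :
    Integrable (fun ω => e ω a * f ω b) μ :=
  (he.eval a).integrable_mul (hf.eval b)

theorem crossMoment_add_left (he : MemLp e 2 μ) (he' : MemLp e' 2 μ) (hf : MemLp f 2 μ) :
    crossMoment μ (fun ω => e ω + e' ω) f = crossMoment μ e f + crossMoment μ e' f := by
  ext a b
  simp only [crossMoment_apply, Matrix.add_apply, Pi.add_apply, add_mul]
  exact integral_add (integrable_mul_coord he hf a b) (integrable_mul_coord he' hf a b)

theorem crossMoment_sub_left (he : MemLp e 2 μ) (he' : MemLp e' 2 μ) (hf : MemLp f 2 μ) :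
    crossMoment μ (fun ω => e ω - e' ω) f = crossMoment μ e f - crossMoment μ e' f := by
  ext a b
  simp only [crossMoment_apply, Matrix.sub_apply, Pi.sub_apply, sub_mul]
  exact integral_sub (integrable_mul_coord he hf a b) (integrable_mul_coord he' hf a b)

theorem crossMoment_sum_left {ι : Type*} (I : Finset ι) {e : ι → Ω → k → ℝ}
    (he : ∀ i, MemLp (e i) 2 μ) (hf : MemLp f 2 μ) :
    crossMoment μ (fun ω => ∑ i ∈ I, e i ω) f = ∑ i ∈ I, crossMoment μ (e i) f := by
  ext a b
  simp only [crossMoment_apply, Matrix.sum_apply, Finset.sum_apply, Finset.sum_mul]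
  exact integral_finsetSum _ fun i _ => integrable_mul_coord (he i) hf a b

theorem crossMoment_mulVec_left (B : Matrix r k ℝ) (he : MemLp e 2 μ) (hf : MemLp f 2 μ) :
    crossMoment μ (fun ω => B *ᵥ e ω) f = B * crossMoment μ e f := by
  ext a b
  simp only [crossMoment_apply, Matrix.mul_apply, Matrix.mulVec, dotProduct, Finset.sum_mul,
    mul_assoc]
  rw [integral_finsetSum _ fun c _ => (integrable_mul_coord he hf c b).const_mul _]
  simp only [integral_const_mul]

theorem crossMoment_add_right (he : MemLp e 2 μ) (hf : MemLp f 2 μ) (hf' : MemLp f' 2 μ) :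
    crossMoment μ e (fun ω => f ω + f' ω) = crossMoment μ e f + crossMoment μ e f' := by
  rw [← crossMoment_transpose, crossMoment_add_left hf hf' he, Matrix.transpose_add,
    crossMoment_transpose, crossMoment_transpose]

theorem crossMoment_sub_right (he : MemLp e 2 μ) (hf : MemLp f 2 μ) (hf' : MemLp f' 2 μ) :
    crossMoment μ e (fun ω => f ω - f' ω) = crossMoment μ e f - crossMoment μ e f' := by
  rw [← crossMoment_transpose, crossMoment_sub_left hf hf' he, Matrix.transpose_sub,
    crossMoment_transpose, crossMoment_transpose]

theorem crossMoment_sum_right {ι : Type*} (I : Finset ι) {f : ι → Ω → l → ℝ}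
    (he : MemLp e 2 μ) (hf : ∀ i, MemLp (f i) 2 μ) :
    crossMoment μ e (fun ω => ∑ i ∈ I, f i ω) = ∑ i ∈ I, crossMoment μ e (f i) := by
  rw [← crossMoment_transpose, crossMoment_sum_left I hf he, Matrix.transpose_sum]
  simp only [crossMoment_transpose]

theorem crossMoment_mulVec_right (B : Matrix r l ℝ) (he : MemLp e 2 μ) (hf : MemLp f 2 μ) :
    crossMoment μ e (fun ω => B *ᵥ f ω) = crossMoment μ e f * Bᵀ := by
  rw [← crossMoment_transpose, crossMoment_mulVec_left B hf he, Matrix.transpose_mul,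
    crossMoment_transpose]

theorem crossMoment_add_self_of_eq_zero (he : MemLp e 2 μ) (he' : MemLp e' 2 μ)
    (h : crossMoment μ e e' = 0) :
    crossMoment μ (fun ω => e ω + e' ω) (fun ω => e ω + e' ω) =
      crossMoment μ e e + crossMoment μ e' e' := by
  have h' : crossMoment μ e' e = 0 := by rw [← crossMoment_transpose, h, Matrix.transpose_zero]
  have hsum : MemLp (fun ω => e ω + e' ω) 2 μ := he.add he'
  rw [crossMoment_add_left he he' hsum, crossMoment_add_right he he he',
    crossMoment_add_right he' he he', h, h', add_zero, zero_add]

theorem crossMoment_self_nonneg (he : MemLp e 2 μ) : 0 ≤ crossMoment μ e e := by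
  refine LoewnerOrder.nonneg_iff_dotProduct.2 ⟨crossMoment_transpose e e, fun x => ?_⟩
  set B : Matrix Unit k ℝ := Matrix.of fun _ a => x a
  have hquad : x ⬝ᵥ crossMoment μ e e *ᵥ x = (B * crossMoment μ e e * Bᵀ) () () := by
    rw [Matrix.mul_assoc, Matrix.mul_apply]
    rfl
  rw [hquad, ← crossMoment_mulVec_left B he he,
    ← crossMoment_mulVec_right B (memLp_mulVec B he) he, crossMoment_apply]
  exact integral_nonneg fun ω => mul_self_nonneg _

end Bilinear

section Gaussian

variable [Fintype k] [DecidableEq k] {e : Ω → k → ℝ} {S : Matrix k k ℝ}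

theorem memLp_eval_multivariateGaussian (a : k) :
    MemLp (fun x : EuclideanSpace ℝ k => x a) 2 (multivariateGaussian 0 S) :=
  (EuclideanSpace.proj (𝕜 := ℝ) a).comp_memLp'
    (IsGaussian.memLp_two_id (μ := multivariateGaussian (0 : EuclideanSpace ℝ k) S))

theorem integral_eval_multivariateGaussian (a : k) :
    ∫ x, x a ∂(multivariateGaussian (0 : EuclideanSpace ℝ k) S) = 0 := by
  have h := (EuclideanSpace.proj (𝕜 := ℝ) a).integral_comp_comm
    (IsGaussian.integrable_id (μ := multivariateGaussian (0 : EuclideanSpace ℝ k) S))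
  simp only [id, integral_id_multivariateGaussian, map_zero] at h
  exact h

theorem memLp_of_hasLaw (he : Measurable e)
    (hlaw : HasLaw (fun ω => WithLp.toLp 2 (e ω)) (multivariateGaussian 0 S) μ) :
    MemLp e 2 μ :=
  memLp_pi_iff.2 fun a => (memLp_eval_multivariateGaussian a).comp_measurePreserving
    (hlaw.measurePreserving (by fun_prop))

theorem integral_of_hasLaw
    (hlaw : HasLaw (fun ω => WithLp.toLp 2 (e ω)) (multivariateGaussian 0 S) μ) (a : k) :
    ∫ ω, e ω a ∂μ = 0 := by
  rw [← integral_eval_multivariateGaussian (S := S) a]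
  exact hlaw.integral_comp (f := fun x : EuclideanSpace ℝ k => x a)
    (memLp_eval_multivariateGaussian a).1

theorem crossMoment_of_hasLaw [IsProbabilityMeasure μ] (he : Measurable e) (hS : S.PosSemidef)
    (hlaw : HasLaw (fun ω => WithLp.toLp 2 (e ω)) (multivariateGaussian 0 S) μ) :
    crossMoment μ e e = S := by
  ext a b
  have hL := memLp_of_hasLaw he hlaw
  have hcov := covariance_eq_sub (hL.eval a) (hL.eval b)
  rw [integral_of_hasLaw hlaw, zero_mul, sub_zero] at hcov
  rw [← covariance_eval_multivariateGaussian (μ := 0) hS a b]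
  exact hcov.symm.trans (hlaw.covariance_comp (f := fun x : EuclideanSpace ℝ k => x a)
    (g := fun x : EuclideanSpace ℝ k => x b) (memLp_eval_multivariateGaussian a).1.aemeasurable
    (memLp_eval_multivariateGaussian b).1.aemeasurable)

end Gaussian

end SecondMoment

/-- An integrable random vector whose conditional mean given the σ-algebra `𝒢` vanishes. -/
structure CondCentered {Ω E : Type*} [NormedAddCommGroup E] [NormedSpace ℝ E] [CompleteSpace E]
    (𝒢 : MeasurableSpace Ω) {mΩ : MeasurableSpace Ω} (μ : Measure Ω) (f : Ω → E) : Prop where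
  integrable : Integrable f μ
  condExp_eq_zero : μ[f | 𝒢] =ᵐ[μ] 0

namespace CondCentered

variable {E F : Type*} [NormedAddCommGroup E] [NormedSpace ℝ E] [CompleteSpace E]
  [NormedAddCommGroup F] [NormedSpace ℝ F] [CompleteSpace F]
  {Ω : Type*} {𝒢 ℋ mΩ : MeasurableSpace Ω} {μ : Measure Ω} {f g : Ω → E}

theorem add (hf : CondCentered 𝒢 μ f) (hg : CondCentered 𝒢 μ g) :
    CondCentered 𝒢 μ fun ω => f ω + g ω :=
  ⟨hf.integrable.add hg.integrable, by
    refine (condExp_add hf.integrable hg.integrable 𝒢).trans ?_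
    simpa only [add_zero] using hf.condExp_eq_zero.add hg.condExp_eq_zero⟩

theorem sub (hf : CondCentered 𝒢 μ f) (hg : CondCentered 𝒢 μ g) :
    CondCentered 𝒢 μ fun ω => f ω - g ω :=
  ⟨hf.integrable.sub hg.integrable, by
    refine (condExp_sub hf.integrable hg.integrable 𝒢).trans ?_
    simpa only [sub_zero] using hf.condExp_eq_zero.sub hg.condExp_eq_zero⟩

theorem sum {ι : Type*} (I : Finset ι) {f : ι → Ω → E} (hf : ∀ i, CondCentered 𝒢 μ (f i)) :
    CondCentered 𝒢 μ fun ω => ∑ i ∈ I, f i ω := by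
  classical
  induction I using Finset.induction_on with
  | empty =>
    simp only [Finset.sum_empty]
    exact ⟨integrable_zero _ _ _, Eventually.of_forall fun ω => congrFun condExp_zero ω⟩
  | insert i I hi ih =>
    simp only [Finset.sum_insert hi]
    exact (hf i).add ih

theorem map (L : E →L[ℝ] F) (hf : CondCentered 𝒢 μ f) : CondCentered 𝒢 μ fun ω => L (f ω) := by
  refine ⟨L.integrable_comp hf.integrable, (L.comp_condExp_comm hf.integrable).symm.trans ?_⟩
  filter_upwards [hf.condExp_eq_zero] with ω h
  simp only [Function.comp_apply, h, Pi.zero_apply, map_zero]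

theorem mulVec {k l : Type*} [Fintype k] [Fintype l] (B : Matrix l k ℝ) {f : Ω → k → ℝ}
    (hf : CondCentered 𝒢 μ f) : CondCentered 𝒢 μ fun ω => B *ᵥ f ω :=
  hf.map B.mulVecLin.toContinuousLinearMap

theorem smul {φ : Ω → ℝ} (h𝒢 : 𝒢 ≤ mΩ) (hφ : Measurable[𝒢] φ) {c : ℝ} (hc : ∀ ω, ‖φ ω‖ ≤ c)
    (hf : CondCentered 𝒢 μ f) : CondCentered 𝒢 μ fun ω => φ ω • f ω := by
  have hint : Integrable (fun ω => φ ω • f ω) μ :=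
    hf.integrable.bdd_smul c (hφ.mono h𝒢 le_rfl).aestronglyMeasurable (Eventually.of_forall hc)
  refine ⟨hint, (condExp_smul_of_aestronglyMeasurable_left
    hφ.stronglyMeasurable.aestronglyMeasurable hint hf.integrable).trans ?_⟩
  filter_upwards [hf.condExp_eq_zero] with ω h
  simp only [Pi.smul_apply', h, Pi.zero_apply, smul_zero]

theorem of_indep [IsFiniteMeasure μ] (hℋ : ℋ ≤ mΩ) (h𝒢 : 𝒢 ≤ mΩ)
    (hind : Indep ℋ 𝒢 μ) (hf : StronglyMeasurable[ℋ] f) (hint : Integrable f μ)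
    (hzero : ∫ ω, f ω ∂μ = 0) : CondCentered 𝒢 μ f :=
  ⟨hint, (condExp_indep_eq hℋ h𝒢 hf hind).trans (Eventually.of_forall fun _ => hzero)⟩

theorem condExp_add_eq [IsFiniteMeasure μ] (h𝒢 : 𝒢 ≤ mΩ) (hf : CondCentered 𝒢 μ f)
    (hg : StronglyMeasurable[𝒢] g) (hint : Integrable g μ) :
    μ[fun ω => f ω + g ω | 𝒢] =ᵐ[μ] g := by
  refine (condExp_add hf.integrable hint 𝒢).trans ?_
  rw [condExp_of_stronglyMeasurable h𝒢 hg hint]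
  filter_upwards [hf.condExp_eq_zero] with ω h
  simp only [Pi.add_apply, h, Pi.zero_apply, zero_add]

end CondCentered

namespace ProcessingNetwork

open LoewnerOrder

variable {n s : ℕ} {m : Fin (s + 1) → ℕ} (N : ProcessingNetwork n s m)

section Covariance

variable (δ : Fin (s + 1) → ℕ) (K : ∀ i, Matrix (Fin n) (Fin (m i)) ℝ)

/-- Noise covariance of sensor `i` inflated by packet loss, when the predicted error covariance
is `M`. -/
noncomputable def inflatedNoise (M : Matrix (Fin n) (Fin n) ℝ) (i : Fin (s + 1)) :
    Matrix (Fin (m i)) (Fin (m i)) ℝ :=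
  (1 - N.lam i) • (N.C i * M * (N.C i)ᵀ) + N.R i (δ i)

/-- The part of the predicted error that remains, in the mean over the arrivals, after the
measurement update with gains `K`. -/
noncomputable def meanResidual : Matrix (Fin n) (Fin n) ℝ :=
  1 - ∑ i, N.lam i • (K i * N.C i)

/-- Error covariance after the measurement update with arbitrary gains `K`, averaged over the
arrivals. -/
noncomputable def josephUpdate (M : Matrix (Fin n) (Fin n) ℝ) : Matrix (Fin n) (Fin n) ℝ :=
  N.meanResidual K * M * (N.meanResidual K)ᵀ +
    ∑ i, N.lam i • (K i * N.inflatedNoise δ M i * (K i)ᵀ)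

/-- One step of the predicted error covariance with gains `K`. -/
noncomputable def covStep (M : Matrix (Fin n) (Fin n) ℝ) : Matrix (Fin n) (Fin n) ℝ :=
  N.timeUpdate (N.josephUpdate δ K M)

/-- The weights of `propagate`: `none` is the mean error dynamics, `some i` the fluctuation due to
the arrivals of sensor `i`. -/
def propagateWeight (j : Option (Fin (s + 1))) : ℝ :=
  j.elim 1 fun i => N.lam i * (1 - N.lam i)

/-- The matrices of `propagate`, indexed like `propagateWeight`. -/
noncomputable def propagateFactor (j : Option (Fin (s + 1))) : Matrix (Fin n) (Fin n) ℝ :=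
  j.elim (N.A * N.meanResidual K) fun i => N.A * (K i * N.C i)

/-- The linear part of `covStep`. -/
noncomputable def propagate : Module.End ℝ (Matrix (Fin n) (Fin n) ℝ) :=
  congruenceSum N.propagateWeight (N.propagateFactor K)

/-- The adjoint of `propagate` for the pairing `(Z, M) ↦ (Z * M).trace`. -/
noncomputable def propagateAdjoint : Module.End ℝ (Matrix (Fin n) (Fin n) ℝ) :=
  congruenceSum N.propagateWeight fun j => (N.propagateFactor K j)ᵀ

/-- The constant part of `covStep`. -/
noncomputable def injectedNoise : Matrix (Fin n) (Fin n) ℝ :=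
  N.Q + ∑ i, N.lam i • (N.A * K i * N.R i (δ i) * (N.A * K i)ᵀ)

variable {δ} {K}

theorem lam_nonneg (i) : 0 ≤ N.lam i := (N.lam_mem i).1

theorem one_sub_lam_nonneg (i) : 0 ≤ 1 - N.lam i := sub_nonneg.2 (N.lam_mem i).2

theorem propagateWeight_nonneg : ∀ j, 0 ≤ N.propagateWeight j
  | none => zero_le_one
  | some i => mul_nonneg (N.lam_nonneg i) (N.one_sub_lam_nonneg i)

theorem propagate_nonneg (M : Matrix (Fin n) (Fin n) ℝ) (hM : 0 ≤ M) : 0 ≤ N.propagate K M :=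
  congruenceSum_nonneg N.propagateWeight_nonneg hM

theorem propagateAdjoint_nonneg (Z : Matrix (Fin n) (Fin n) ℝ) (hZ : 0 ≤ Z) :
    0 ≤ N.propagateAdjoint K Z :=
  congruenceSum_nonneg N.propagateWeight_nonneg hZ

theorem trace_mul_propagate (Z M : Matrix (Fin n) (Fin n) ℝ) :
    (Z * N.propagate K M).trace = (N.propagateAdjoint K Z * M).trace :=
  trace_mul_congruenceSum Z M

theorem propagate_apply (M : Matrix (Fin n) (Fin n) ℝ) :
    N.propagate K M = N.A * N.meanResidual K * M * (N.A * N.meanResidual K)ᵀ +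
      ∑ i, (N.lam i * (1 - N.lam i)) •
        (N.A * (K i * N.C i) * M * (N.A * (K i * N.C i))ᵀ) := by
  simp only [propagate, congruenceSum, LinearMap.coe_mk, AddHom.coe_mk, Fintype.sum_option,
    propagateWeight, propagateFactor, Option.elim, one_smul]

theorem propagateAdjoint_apply (Z : Matrix (Fin n) (Fin n) ℝ) :
    N.propagateAdjoint K Z =
      (N.A * N.meanResidual K)ᵀ * Z * (N.A * N.meanResidual K)ᵀᵀ +
      ∑ i, (N.lam i * (1 - N.lam i)) •
        ((N.A * (K i * N.C i))ᵀ * Z * (N.A * (K i * N.C i))ᵀᵀ) := by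
  simp only [propagateAdjoint, congruenceSum, LinearMap.coe_mk, AddHom.coe_mk, Fintype.sum_option,
    propagateWeight, propagateFactor, Option.elim, one_smul]

theorem covStep_eq (M : Matrix (Fin n) (Fin n) ℝ) :
    N.covStep δ K M = N.propagate K M + N.injectedNoise δ K := by
  simp only [propagate_apply, covStep, timeUpdate, josephUpdate, inflatedNoise, injectedNoise,
    Matrix.transpose_mul, Matrix.mul_add, Matrix.add_mul, Matrix.mul_sum, Matrix.sum_mul,
    Matrix.mul_smul, Matrix.smul_mul, smul_add, smul_smul, Finset.sum_add_distrib,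
    Matrix.mul_assoc]
  abel

theorem covStep_iterate_sub (t : ℕ) (M M' : Matrix (Fin n) (Fin n) ℝ) :
    (N.covStep δ K)^[t] M - (N.covStep δ K)^[t] M' = (N.propagate K ^ t) (M - M') := by
  induction t with
  | zero => rfl
  | succ t ih =>
    rw [Function.iterate_succ_apply', Function.iterate_succ_apply', covStep_eq, covStep_eq,
      add_sub_add_right_eq_sub, ← map_sub, ih, pow_succ', Module.End.mul_apply]

theorem R_nonneg (hδ : ∀ i, 0 < δ i) (i) : 0 ≤ N.R i (δ i) :=
  (N.R_posDef i _ (hδ i)).posSemidef.nonneg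

theorem injectedNoise_nonneg (hδ : ∀ i, 0 < δ i) : 0 ≤ N.injectedNoise δ K :=
  add_nonneg N.Q_posSemidef.nonneg (Finset.sum_nonneg fun i _ =>
    smul_nonneg (N.lam_nonneg i) (conj_nonneg (N.R_nonneg hδ i) _))

theorem covStep_nonneg (hδ : ∀ i, 0 < δ i) {M : Matrix (Fin n) (Fin n) ℝ} (hM : 0 ≤ M) :
    0 ≤ N.covStep δ K M := by
  rw [covStep_eq]
  exact add_nonneg (N.propagate_nonneg M hM) (N.injectedNoise_nonneg hδ)

theorem timeUpdate_mono : Monotone N.timeUpdate := fun _ _ h =>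
  add_le_add_left (conj_mono N.A h) N.Q

theorem covStep_mono : Monotone (N.covStep δ K) := fun M M' h => by
  rw [covStep_eq, covStep_eq]
  exact add_le_add_left (monotone_of_map_nonneg N.propagate_nonneg h) _

theorem josephUpdate_mono : Monotone (N.josephUpdate δ K) := fun _ _ h =>
  add_le_add (conj_mono _ h) (Finset.sum_le_sum fun i _ => smul_le_smul_of_nonneg_left
    (conj_mono (K i) (add_le_add_left (smul_le_smul_of_nonneg_left (conj_mono (N.C i) h)
      (N.one_sub_lam_nonneg i)) _)) (N.lam_nonneg i))

theorem josephUpdate_eq_sub_sub_add {M : Matrix (Fin n) (Fin n) ℝ} (hM : Mᵀ = M) :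
    N.josephUpdate δ K M =
      M - ∑ i, N.lam i • (M * (K i * N.C i)ᵀ) - ∑ i, N.lam i • (M * (K i * N.C i)ᵀ)ᵀ +
        ∑ i, ∑ j, ((N.lam i * N.lam j) • ((K i * N.C i) * M * (K j * N.C j)ᵀ) +
          if i = j then N.lam i • (K i * N.inflatedNoise δ M i * (K i)ᵀ) else 0) := by
  have hdouble : ∑ i, ∑ j, (N.lam i * N.lam j) • ((K i * N.C i) * M * (K j * N.C j)ᵀ) =
      (∑ i, N.lam i • (K i * N.C i)) * M * (∑ i, N.lam i • (K i * N.C i))ᵀ := by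
    rw [Finset.sum_comm]
    simp only [Matrix.transpose_sum, Matrix.sum_mul, Matrix.mul_sum, Matrix.transpose_smul,
      Matrix.mul_smul, Matrix.smul_mul, Finset.smul_sum, smul_smul, mul_comm]
  have hright : ∑ i, N.lam i • (M * (K i * N.C i)ᵀ) = M * (∑ i, N.lam i • (K i * N.C i))ᵀ := by
    simp only [Matrix.transpose_sum, Matrix.mul_sum, Matrix.mul_smul, Matrix.transpose_smul]
  have hleft : ∑ i, N.lam i • (M * (K i * N.C i)ᵀ)ᵀ = (∑ i, N.lam i • (K i * N.C i)) * M := by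
    simp only [Matrix.transpose_mul, Matrix.transpose_transpose, hM, Matrix.sum_mul,
      Matrix.smul_mul]
  simp only [Finset.sum_add_distrib, Finset.sum_ite_eq, Finset.mem_univ, if_true]
  rw [hdouble, hright, hleft, josephUpdate, meanResidual]
  simp only [Matrix.transpose_sub, Matrix.transpose_one, Matrix.mul_sub, Matrix.sub_mul,
    Matrix.mul_one, Matrix.one_mul]
  abel

end Covariance

section Optimality

variable {δ : Fin (s + 1) → ℕ} {d : ℕ} {M : Matrix (Fin n) (Fin n) ℝ}
  {K : ∀ i, Matrix (Fin n) (Fin (m i)) ℝ}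

theorem inflatedNoise_posDef (hδ : ∀ i, 0 < δ i) (hM : 0 ≤ M) (i) :
    (N.inflatedNoise δ M i).PosDef :=
  (N.R_posDef i _ (hδ i)).posSemidef_add
    (smul_nonneg (N.one_sub_lam_nonneg i) (conj_nonneg hM (N.C i))).posSemidef

theorem inflatedNoise_nonneg (hδ : ∀ i, 0 < δ i) (hM : 0 ≤ M) (i) : 0 ≤ N.inflatedNoise δ M i :=
  (N.inflatedNoise_posDef hδ hM i).posSemidef.nonneg

theorem sensorInfo_sub_eq (hδ : ∀ i, 0 < δ i) (hM : M.PosDef) (i) :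
    N.sensorInfo δ i - (1 - N.lam i) •
        (N.sensorInfo δ i * (M⁻¹ + (1 - N.lam i) • N.sensorInfo δ i)⁻¹ * N.sensorInfo δ i) =
      (N.C i)ᵀ * (N.inflatedNoise δ M i)⁻¹ * N.C i := by
  have hR := N.R_posDef i _ (hδ i)
  have hpos : (M⁻¹ + (1 - N.lam i) • N.sensorInfo δ i).PosDef :=
    hM.inv.add_posSemidef (smul_nonneg (N.one_sub_lam_nonneg i)
      (conj_transpose_nonneg hR.inv.posSemidef.nonneg (N.C i))).posSemidef
  have hinfo : M⁻¹ + (N.C i)ᵀ * (N.R i (δ i))⁻¹ * ((1 - N.lam i) • N.C i) =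
      M⁻¹ + (1 - N.lam i) • N.sensorInfo δ i := by
    rw [Matrix.mul_smul, sensorInfo]
  have hnoise : N.inflatedNoise δ M i =
      N.R i (δ i) + ((1 - N.lam i) • N.C i) * M * (N.C i)ᵀ := by
    rw [inflatedNoise, add_comm, Matrix.smul_mul, Matrix.smul_mul]
  rw [hnoise, Matrix.add_mul_mul_inv_eq_sub _ _ _ _ hR.isUnit hM.isUnit
    (hinfo.symm ▸ hpos.isUnit), hinfo]
  simp only [sensorInfo, Matrix.mul_sub, Matrix.sub_mul, Matrix.mul_smul, Matrix.smul_mul,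
    Matrix.mul_assoc]

theorem dataInfo_eq (hδ : ∀ i, 0 < δ i) (hM : M.PosDef) :
    N.dataInfo δ d M =
      ∑ i ∈ N.activeSensors δ d, N.lam i • ((N.C i)ᵀ * (N.inflatedNoise δ M i)⁻¹ * N.C i) :=
  Finset.sum_congr rfl fun i _ => by rw [N.sensorInfo_sub_eq hδ hM]

theorem posDef_inv_add_dataInfo (hδ : ∀ i, 0 < δ i) (hM : M.PosDef) :
    (M⁻¹ + N.dataInfo δ d M).PosDef := by
  have hinfo : 0 ≤ N.dataInfo δ d M := by
    rw [N.dataInfo_eq hδ hM]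
    exact Finset.sum_nonneg fun i _ => smul_nonneg (N.lam_nonneg i) (conj_transpose_nonneg
      (N.inflatedNoise_posDef hδ hM.posSemidef.nonneg i).inv.posSemidef.nonneg _)
  exact hM.inv.add_posSemidef hinfo.posSemidef

theorem measUpdate_posDef (hδ : ∀ i, 0 < δ i) (hM : M.PosDef) : (N.measUpdate δ d M).PosDef :=
  (N.posDef_inv_add_dataInfo hδ hM).inv

theorem kfStep_nonneg (hδ : ∀ i, 0 < δ i) (hM : M.PosDef) : 0 ≤ N.kfStep δ d M :=
  add_nonneg (conj_nonneg (N.measUpdate_posDef hδ hM).posSemidef.nonneg N.A)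
    N.Q_posSemidef.nonneg

/-- The Kalman gain for data of delay `d`, extended by `0` to the sensors without such data. -/
noncomputable def activeKalmanGain (δ : Fin (s + 1) → ℕ) (d : ℕ) (M : Matrix (Fin n) (Fin n) ℝ)
    (i : Fin (s + 1)) : Matrix (Fin n) (Fin (m i)) ℝ :=
  if i ∈ N.activeSensors δ d then N.kalmanGain δ d M i else 0

theorem activeKalmanGain_of_notMem (i) (hi : i ∉ N.activeSensors δ d) :
    N.activeKalmanGain δ d M i = 0 :=
  if_neg hi

theorem activeKalmanGain_mul_inflatedNoise (hδ : ∀ i, 0 < δ i) (hM : M.PosDef) {i}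
    (hi : i ∈ N.activeSensors δ d) :
    N.activeKalmanGain δ d M i * N.inflatedNoise δ M i = N.measUpdate δ d M * (N.C i)ᵀ := by
  rw [activeKalmanGain, if_pos hi, kalmanGain, ← inflatedNoise, Matrix.mul_assoc,
    posDef_inv_mul (N.inflatedNoise_posDef hδ hM.posSemidef.nonneg i), Matrix.mul_one]

theorem inflatedNoise_mul_activeKalmanGain_transpose (hδ : ∀ i, 0 < δ i) (hM : M.PosDef) {i}
    (hi : i ∈ N.activeSensors δ d) :
    N.inflatedNoise δ M i * (N.activeKalmanGain δ d M i)ᵀ = N.C i * N.measUpdate δ d M := by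
  rw [← transpose_eq_of_nonneg (N.inflatedNoise_nonneg hδ hM.posSemidef.nonneg i),
    ← Matrix.transpose_mul, N.activeKalmanGain_mul_inflatedNoise hδ hM hi, Matrix.transpose_mul,
    transpose_transpose, transpose_eq_of_nonneg (N.measUpdate_posDef hδ hM).posSemidef.nonneg]

theorem meanResidual_activeKalmanGain (hδ : ∀ i, 0 < δ i) (hM : M.PosDef) :
    N.meanResidual (N.activeKalmanGain δ d M) * M = N.measUpdate δ d M := by
  have hsum : ∑ i, N.lam i • (N.activeKalmanGain δ d M i * N.C i) =
      N.measUpdate δ d M * N.dataInfo δ d M := by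
    rw [N.dataInfo_eq hδ hM, Matrix.mul_sum]
    refine (Finset.sum_subset (Finset.subset_univ _) fun i _ hi => ?_).symm.trans
      (Finset.sum_congr rfl fun i hi => ?_)
    · rw [N.activeKalmanGain_of_notMem i hi, Matrix.zero_mul, smul_zero]
    · rw [activeKalmanGain, if_pos hi, kalmanGain, ← inflatedNoise, Matrix.mul_smul]
      simp only [Matrix.mul_assoc]
  have hres : N.meanResidual (N.activeKalmanGain δ d M) = N.measUpdate δ d M * M⁻¹ := by
    rw [meanResidual, hsum, sub_eq_iff_eq_add, ← Matrix.mul_add]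
    exact (posDef_inv_mul (N.posDef_inv_add_dataInfo hδ hM)).symm
  rw [hres, Matrix.mul_assoc, posDef_inv_mul hM, Matrix.mul_one]

theorem mul_meanResidual_activeKalmanGain_transpose (hδ : ∀ i, 0 < δ i) (hM : M.PosDef) :
    M * (N.meanResidual (N.activeKalmanGain δ d M))ᵀ = N.measUpdate δ d M := by
  rw [← transpose_eq_of_nonneg (N.measUpdate_posDef hδ hM).posSemidef.nonneg,
    ← N.meanResidual_activeKalmanGain hδ hM, Matrix.transpose_mul,
    transpose_eq_of_nonneg hM.posSemidef.nonneg]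

/-- Completion of the square: `horth` are the normal equations tested against `D`. -/
theorem josephUpdate_add (hδ : ∀ i, 0 < δ i) (hM : 0 ≤ M)
    {D : ∀ i, Matrix (Fin n) (Fin (m i)) ℝ}
    (horth : ∀ i, D i * (N.inflatedNoise δ M i * (K i)ᵀ) =
      D i * (N.C i * (M * (N.meanResidual K)ᵀ))) :
    N.josephUpdate δ (K + D) M = N.josephUpdate δ K M +
      ((∑ i, N.lam i • (D i * N.C i)) * M * (∑ i, N.lam i • (D i * N.C i))ᵀ +
        ∑ i, N.lam i • (D i * N.inflatedNoise δ M i * (D i)ᵀ)) := by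
  set X := N.meanResidual K
  set E := ∑ i, N.lam i • (D i * N.C i) with hE
  have hcross : ∑ i, N.lam i • (D i * N.inflatedNoise δ M i * (K i)ᵀ) = E * M * Xᵀ := by
    simp only [hE, Matrix.sum_mul, Matrix.smul_mul, Matrix.mul_assoc, horth]
  have hcrossT : ∑ i, N.lam i • (K i * N.inflatedNoise δ M i * (D i)ᵀ) = X * M * Eᵀ := by
    simpa only [Matrix.transpose_sum, Matrix.transpose_smul, Matrix.transpose_mul,
      transpose_transpose, transpose_eq_of_nonneg (N.inflatedNoise_nonneg hδ hM _),
      transpose_eq_of_nonneg hM, Matrix.mul_assoc] using congrArg Matrix.transpose hcross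
  have hres : N.meanResidual (K + D) = X - E := by
    simp only [X, meanResidual, hE, Pi.add_apply, Matrix.add_mul, smul_add,
      Finset.sum_add_distrib, sub_sub]
  have hsum : ∑ i, N.lam i • ((K + D) i * N.inflatedNoise δ M i * ((K + D) i)ᵀ) =
      ∑ i, N.lam i • (K i * N.inflatedNoise δ M i * (K i)ᵀ) + X * M * Eᵀ + E * M * Xᵀ +
        ∑ i, N.lam i • (D i * N.inflatedNoise δ M i * (D i)ᵀ) := by
    rw [← hcross, ← hcrossT]
    simp only [Pi.add_apply, Matrix.transpose_add, Matrix.add_mul, Matrix.mul_add, smul_add,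
      Finset.sum_add_distrib]
    abel
  rw [josephUpdate, josephUpdate, hres, hsum, Matrix.transpose_sub, Matrix.mul_sub,
    Matrix.sub_mul, Matrix.sub_mul, Matrix.sub_mul]
  abel

theorem josephUpdate_activeKalmanGain (hδ : ∀ i, 0 < δ i) (hM : M.PosDef) :
    N.josephUpdate δ (N.activeKalmanGain δ d M) M = N.measUpdate δ d M := by
  set κ := N.activeKalmanGain δ d M with hκ
  set U := N.measUpdate δ d M
  have hMX : M * (N.meanResidual κ)ᵀ = U := N.mul_meanResidual_activeKalmanGain_transpose hδ hM
  have hterm (i) : κ i * N.inflatedNoise δ M i * (κ i)ᵀ = κ i * N.C i * U := by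
    by_cases hi : i ∈ N.activeSensors δ d
    · rw [Matrix.mul_assoc, N.inflatedNoise_mul_activeKalmanGain_transpose hδ hM hi,
        Matrix.mul_assoc]
    · simp only [hκ, N.activeKalmanGain_of_notMem i hi, Matrix.zero_mul]
  calc N.josephUpdate δ κ M
      = N.meanResidual κ * U + (∑ i, N.lam i • (κ i * N.C i)) * U := by
        simp only [josephUpdate, Matrix.mul_assoc (N.meanResidual κ), hMX, hterm, Matrix.sum_mul,
          Matrix.smul_mul]
    _ = U := by rw [← Matrix.add_mul, meanResidual, sub_add_cancel, Matrix.one_mul]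

theorem measUpdate_le_josephUpdate (hδ : ∀ i, 0 < δ i) (hM : M.PosDef)
    (hK : ∀ i, i ∉ N.activeSensors δ d → K i = 0) :
    N.measUpdate δ d M ≤ N.josephUpdate δ K M := by
  have horth (i) : (K - N.activeKalmanGain δ d M) i *
      (N.inflatedNoise δ M i * (N.activeKalmanGain δ d M i)ᵀ) =
      (K - N.activeKalmanGain δ d M) i *
        (N.C i * (M * (N.meanResidual (N.activeKalmanGain δ d M))ᵀ)) := by
    by_cases hi : i ∈ N.activeSensors δ d
    · rw [N.inflatedNoise_mul_activeKalmanGain_transpose hδ hM hi,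
        N.mul_meanResidual_activeKalmanGain_transpose hδ hM]
    · simp only [Pi.sub_apply, hK i hi, N.activeKalmanGain_of_notMem i hi, sub_zero,
        Matrix.zero_mul]
  have h := N.josephUpdate_add hδ hM.posSemidef.nonneg horth
  rw [add_sub_cancel, N.josephUpdate_activeKalmanGain hδ hM] at h
  rw [h]
  exact le_add_of_nonneg_right (add_nonneg (conj_nonneg hM.posSemidef.nonneg _)
    (Finset.sum_nonneg fun i _ => smul_nonneg (N.lam_nonneg i)
      (conj_nonneg (N.inflatedNoise_nonneg hδ hM.posSemidef.nonneg i) _)))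

theorem covStep_activeKalmanGain (hδ : ∀ i, 0 < δ i) (hM : M.PosDef) :
    N.covStep δ (N.activeKalmanGain δ d M) M = N.kfStep δ d M := by
  rw [covStep, N.josephUpdate_activeKalmanGain hδ hM, kfStep]

theorem kfStep_le_covStep (hδ : ∀ i, 0 < δ i) (hM : M.PosDef)
    (hK : ∀ i, i ∉ N.activeSensors δ d → K i = 0) : N.kfStep δ d M ≤ N.covStep δ K M :=
  N.timeUpdate_mono (N.measUpdate_le_josephUpdate hδ hM hK)

theorem measUpdate_mono (hδ : ∀ i, 0 < δ i) {M' : Matrix (Fin n) (Fin n) ℝ} (hM : M.PosDef)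
    (h : M ≤ M') : N.measUpdate δ d M ≤ N.measUpdate δ d M' := by
  rw [← N.josephUpdate_activeKalmanGain hδ (posDef_of_le hM h)]
  exact (N.measUpdate_le_josephUpdate hδ hM N.activeKalmanGain_of_notMem).trans
    (N.josephUpdate_mono h)

theorem kfStep_mono (hδ : ∀ i, 0 < δ i) {M' : Matrix (Fin n) (Fin n) ℝ} (hM : M.PosDef)
    (h : M ≤ M') : N.kfStep δ d M ≤ N.kfStep δ d M' :=
  N.timeUpdate_mono (N.measUpdate_mono hδ hM h)

theorem kfStep_anti (hδ : ∀ i, 0 < δ i) {d' : ℕ} (hd : d ≤ d') (hM : M.PosDef) :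
    N.kfStep δ d' M ≤ N.kfStep δ d M := by
  rw [← N.covStep_activeKalmanGain (d := d) hδ hM]
  refine N.kfStep_le_covStep hδ hM fun i hi => N.activeKalmanGain_of_notMem i fun hi' => hi ?_
  exact Finset.mem_filter.2 ⟨Finset.mem_univ i, (Finset.mem_filter.1 hi').2.trans hd⟩

end Optimality

section Stability

variable {δ : Fin (s + 1) → ℕ} {d : ℕ} {K : ∀ i, Matrix (Fin n) (Fin (m i)) ℝ}
  {P Z M : Matrix (Fin n) (Fin n) ℝ}

/-- Mean square stability of the error dynamics with gains `K`. -/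
def IsStabilizing (K : ∀ i, Matrix (Fin n) (Fin (m i)) ℝ) : Prop :=
  ∀ M, 0 ≤ M → Tendsto (fun t => (N.propagate K ^ t) M) atTop (𝓝 0)

variable {N} in
theorem IsStabilizing.eq_zero_of_propagate_eq (hK : N.IsStabilizing K) (hM : 0 ≤ M)
    (h : N.propagate K M = M) : M = 0 := by
  have hpow (t : ℕ) : (N.propagate K ^ t) M = M := by
    rw [Module.End.coe_pow, Function.iterate_fixed h]
  simpa only [hpow, tendsto_const_nhds_iff] using hK M hM

variable {N} in
theorem IsStabilizing.tendsto_covStep (hK : N.IsStabilizing K) (hP : 0 ≤ P) (hM : 0 ≤ M)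
    (h : N.covStep δ K P = P) :
    Tendsto (fun t => (N.covStep δ K)^[t] M) atTop (𝓝 P) := by
  have hsub (t : ℕ) : (N.propagate K ^ t) M - (N.propagate K ^ t) P =
      (N.covStep δ K)^[t] M - P := by
    rw [← map_sub, ← N.covStep_iterate_sub (δ := δ), Function.iterate_fixed h]
  simpa only [hsub, sub_zero, sub_add_cancel, zero_add]
    using ((hK M hM).sub (hK P hP)).add_const P

theorem mul_meanResidual {W : Matrix (Fin n) (Fin n) ℝ} (h : ∀ i, N.lam i • (W * K i) = 0) :
    W * N.meanResidual K = W := by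
  rw [meanResidual, Matrix.mul_sub, Matrix.mul_one, sub_eq_self, Matrix.mul_sum]
  refine Finset.sum_eq_zero fun i _ => ?_
  rw [Matrix.mul_smul, ← Matrix.mul_assoc, ← Matrix.smul_mul, h i, Matrix.zero_mul]

theorem propagateAdjoint_eq_of_mul_eq_zero (hZ : 0 ≤ Z)
    (h : ∀ i, N.lam i • (Z * N.A * K i) = 0) :
    N.propagateAdjoint K Z = N.Aᵀ * Z * N.A := by
  have hres : (N.A * N.meanResidual K)ᵀ * Z = N.Aᵀ * Z := by
    have := congrArg Matrix.transpose (N.mul_meanResidual h)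
    rwa [Matrix.mul_assoc, Matrix.transpose_mul, Matrix.transpose_mul Z,
      transpose_eq_of_nonneg hZ] at this
  rw [propagateAdjoint_apply, hres, transpose_transpose, Matrix.mul_assoc, ← Matrix.mul_assoc Z,
    N.mul_meanResidual h, ← Matrix.mul_assoc, add_eq_left]
  refine Finset.sum_eq_zero fun i _ => ?_
  have hterm : N.lam i • (Z * (N.A * (K i * N.C i))) = 0 := by
    rw [← Matrix.mul_assoc, ← Matrix.mul_assoc, ← Matrix.smul_mul, h i, Matrix.zero_mul]
  rw [transpose_transpose, mul_comm, mul_smul, Matrix.mul_assoc, ← Matrix.mul_smul, hterm,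
    Matrix.mul_zero, smul_zero]

theorem propagate_eq_of_mul_eq_zero (hM : 0 ≤ M)
    (h : ∀ i, N.lam i • (K i * N.C i * M) = 0) : N.propagate K M = N.A * M * N.Aᵀ := by
  have hres : N.meanResidual K * M = M := by
    rw [meanResidual, Matrix.sub_mul, Matrix.one_mul, sub_eq_self, Matrix.sum_mul]
    exact Finset.sum_eq_zero fun i _ => by rw [Matrix.smul_mul, h i]
  have hresT : M * (N.meanResidual K)ᵀ = M := by
    have := congrArg Matrix.transpose hres
    rwa [Matrix.transpose_mul, transpose_eq_of_nonneg hM] at this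
  rw [propagate_apply, Matrix.transpose_mul, Matrix.mul_assoc N.A, hres, ← Matrix.mul_assoc,
    Matrix.mul_assoc N.A, hresT, add_eq_left]
  refine Finset.sum_eq_zero fun i _ => ?_
  have hterm : N.lam i • (N.A * (K i * N.C i) * M) = 0 := by
    rw [Matrix.mul_assoc, ← Matrix.mul_smul, h i, Matrix.mul_zero]
  rw [mul_comm, mul_smul, ← Matrix.smul_mul, hterm, Matrix.zero_mul, smul_zero]

theorem mul_eq_zero_of_trace_mul_injectedNoise (hδ : ∀ i, 0 < δ i) (hZ : 0 ≤ Z)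
    (h : (Z * N.injectedNoise δ K).trace = 0) :
    Z * N.Q = 0 ∧ ∀ i, N.lam i • (Z * N.A * K i) = 0 := by
  have hQ := trace_mul_nonneg hZ N.Q_posSemidef.nonneg
  have hK (i) : 0 ≤ (Z * (N.lam i • (N.A * K i * N.R i (δ i) * (N.A * K i)ᵀ))).trace :=
    trace_mul_nonneg hZ (smul_nonneg (N.lam_nonneg i) (conj_nonneg (N.R_nonneg hδ i) _))
  rw [injectedNoise, Matrix.mul_add, Matrix.trace_add, Matrix.mul_sum, Matrix.trace_sum,
    add_eq_zero_iff_of_nonneg hQ (Finset.sum_nonneg fun i _ => hK i),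
    Finset.sum_eq_zero_iff_of_nonneg fun i _ => hK i] at h
  refine ⟨mul_eq_zero_of_trace_eq_zero hZ N.Q_posSemidef.nonneg h.1, fun i => ?_⟩
  have hi := h.2 i (Finset.mem_univ i)
  rw [Matrix.mul_smul, Matrix.trace_smul, smul_eq_mul] at hi
  rcases mul_eq_zero.1 hi with hi | hi
  · rw [hi, zero_smul]
  · have hR := mul_mul_eq_zero_of_trace_eq_zero hZ (N.R_nonneg hδ i) hi
    rw [Matrix.mul_assoc, ← Matrix.mul_one (Z * _), ← posDef_mul_inv (N.R_posDef i _ (hδ i)),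
      ← Matrix.mul_assoc, hR, Matrix.zero_mul, smul_zero]

theorem mul_measUpdate_of_mul_activeKalmanGain_eq_zero (hδ : ∀ i, 0 < δ i) (hP : P.PosDef)
    {W : Matrix (Fin n) (Fin n) ℝ} (h : ∀ i, N.lam i • (W * N.activeKalmanGain δ d P i) = 0) :
    W * N.measUpdate δ d P = W * P := by
  rw [← N.meanResidual_activeKalmanGain hδ hP, ← Matrix.mul_assoc, N.mul_meanResidual h]

theorem mul_C_transpose_eq_zero_of_mul_activeKalmanGain_eq_zero (hδ : ∀ i, 0 < δ i)
    (hP : P.PosDef) {W : Matrix (Fin n) (Fin n) ℝ}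
    (h : ∀ i, N.lam i • (W * N.activeKalmanGain δ d P i) = 0) {i}
    (hi : i ∈ N.activeSensors δ d) : N.lam i • (W * P * (N.C i)ᵀ) = 0 := by
  rw [← N.mul_measUpdate_of_mul_activeKalmanGain_eq_zero hδ hP h, Matrix.mul_assoc,
    ← N.activeKalmanGain_mul_inflatedNoise hδ hP hi, ← Matrix.mul_assoc, ← Matrix.smul_mul, h i,
    Matrix.zero_mul]

theorem conj_mul_mul_self_eq {A P Z : Matrix (Fin n) (Fin n) ℝ} (hP : Pᵀ = P) (hZ : Zᵀ = Z)
    (hAZA : Aᵀ * Z * A = Z) (hZP : Z * (A * P * Aᵀ) = Z * P) :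
    A * (P * Z * P) * Aᵀ = P * Z * P := by
  have hPZ : A * P * Aᵀ * Z = P * Z := by
    have := congrArg Matrix.transpose hZP
    simpa only [Matrix.transpose_mul, transpose_transpose, hZ, hP, Matrix.mul_assoc] using this
  calc A * (P * Z * P) * Aᵀ = A * P * (Aᵀ * Z * A) * P * Aᵀ := by
        rw [hAZA]; simp only [Matrix.mul_assoc]
    _ = A * P * Aᵀ * (Z * (A * P * Aᵀ)) := by simp only [Matrix.mul_assoc]
    _ = P * Z * P := by rw [hZP, ← Matrix.mul_assoc, hPZ]

/-- The obstruction `Z` to the stability of the Kalman filter would be an undamped mode that no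
gain can stabilize: the propagation with any gains `K` fixes `P * Z * P`. -/
theorem mul_eq_zero_of_propagateAdjoint_activeKalmanGain_eq (hδ : ∀ i, 0 < δ i) (hP : P.PosDef)
    (hfix : N.kfStep δ d P = P) (hKd : ∀ i, i ∉ N.activeSensors δ d → K i = 0)
    (hK : N.IsStabilizing K) (hZ : 0 ≤ Z)
    (hinv : N.propagateAdjoint (N.activeKalmanGain δ d P) Z = Z) : Z * P = 0 := by
  have hZt := transpose_eq_of_nonneg hZ
  have hPt := transpose_eq_of_nonneg hP.posSemidef.nonneg
  have htrace : (Z * N.injectedNoise δ (N.activeKalmanGain δ d P)).trace = 0 := by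
    have := congrArg (fun M => (Z * M).trace) ((N.covStep_activeKalmanGain hδ hP).trans hfix)
    rwa [covStep_eq, Matrix.mul_add, Matrix.trace_add, trace_mul_propagate, hinv,
      add_eq_left] at this
  obtain ⟨hZQ, hZA⟩ := N.mul_eq_zero_of_trace_mul_injectedNoise hδ hZ htrace
  have hAZA : N.Aᵀ * Z * N.A = Z := by
    rw [← N.propagateAdjoint_eq_of_mul_eq_zero hZ hZA, hinv]
  have hZP : Z * (N.A * P * N.Aᵀ) = Z * P := by
    conv_rhs => rw [← hfix, kfStep, timeUpdate, Matrix.mul_add, hZQ, add_zero, ← Matrix.mul_assoc,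
      ← Matrix.mul_assoc, N.mul_measUpdate_of_mul_activeKalmanGain_eq_zero hδ hP hZA]
    simp only [Matrix.mul_assoc]
  have hM : 0 ≤ P * Z * P := by simpa only [hPt] using conj_nonneg hZ P
  have hAM := conj_mul_mul_self_eq hPt hZt hAZA hZP
  have hCM (i) : N.lam i • (K i * N.C i * (P * Z * P)) = 0 := by
    by_cases hi : i ∈ N.activeSensors δ d
    · have hZPC : N.lam i • (Z * P * (N.C i)ᵀ) = 0 := by
        have := N.mul_C_transpose_eq_zero_of_mul_activeKalmanGain_eq_zero hδ hP hZA hi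
        rw [← hAZA, Matrix.mul_assoc N.Aᵀ, Matrix.mul_assoc N.Aᵀ, Matrix.mul_assoc N.Aᵀ,
          ← Matrix.mul_smul, this, Matrix.mul_zero]
      have hCPZ : N.lam i • (N.C i * (P * Z)) = 0 := by
        simpa only [Matrix.transpose_smul, Matrix.transpose_mul, transpose_transpose, hZt, hPt,
          Matrix.transpose_zero] using congrArg Matrix.transpose hZPC
      rw [← Matrix.mul_assoc, Matrix.mul_assoc (K i), ← Matrix.smul_mul, ← Matrix.mul_smul, hCPZ,
        Matrix.mul_zero, Matrix.zero_mul]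
    · rw [hKd i hi, Matrix.zero_mul, Matrix.zero_mul, smul_zero]
  have hzero := hK.eq_zero_of_propagate_eq hM ((N.propagate_eq_of_mul_eq_zero hM hCM).trans hAM)
  rw [← Matrix.one_mul Z, ← posDef_inv_mul hP, Matrix.mul_assoc, Matrix.mul_assoc,
    ← Matrix.mul_assoc P, hzero, Matrix.mul_zero]

theorem isStabilizing_activeKalmanGain (hδ : ∀ i, 0 < δ i) (hP : P.PosDef)
    (hfix : N.kfStep δ d P = P) (hKd : ∀ i, i ∉ N.activeSensors δ d → K i = 0)
    (hK : N.IsStabilizing K) : N.IsStabilizing (N.activeKalmanGain δ d P) := fun _ hM =>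
  tendsto_pow_apply_zero N.propagate_nonneg N.propagateAdjoint_nonneg N.trace_mul_propagate hP
    (by
      conv_rhs => rw [← hfix, ← N.covStep_activeKalmanGain hδ hP, covStep_eq]
      exact le_add_of_nonneg_right (N.injectedNoise_nonneg hδ))
    (fun _ => N.mul_eq_zero_of_propagateAdjoint_activeKalmanGain_eq hδ hP hfix hKd hK) hM

theorem le_of_tendsto_covStep {S : Matrix (Fin n) (Fin n) ℝ} (hP : P ≤ N.covStep δ K P)
    (h : Tendsto (fun t => (N.covStep δ K)^[t] P) atTop (𝓝 S)) : P ≤ S :=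
  ge_of_tendsto' h fun t => N.covStep_mono.monotone_iterate_of_le_map hP (Nat.zero_le t)

theorem kfStep_fixed_unique (hδ : ∀ i, 0 < δ i) {P' : Matrix (Fin n) (Fin n) ℝ}
    (hP : P.PosDef) (hfix : N.kfStep δ d P = P) (hP' : P'.PosDef) (hfix' : N.kfStep δ d P' = P')
    (hKd : ∀ i, i ∉ N.activeSensors δ d → K i = 0) (hK : N.IsStabilizing K) : P = P' := by
  have hle {P P' : Matrix (Fin n) (Fin n) ℝ} (hP : P.PosDef) (hfix : N.kfStep δ d P = P)
      (hP' : P'.PosDef) (hfix' : N.kfStep δ d P' = P') : P ≤ P' := by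
    refine N.le_of_tendsto_covStep (K := N.activeKalmanGain δ d P') ?_
      ((N.isStabilizing_activeKalmanGain hδ hP' hfix' hKd hK).tendsto_covStep
        hP'.posSemidef.nonneg hP.posSemidef.nonneg
        ((N.covStep_activeKalmanGain hδ hP').trans hfix'))
    conv_lhs => rw [← hfix]
    exact N.kfStep_le_covStep hδ hP N.activeKalmanGain_of_notMem
  exact le_antisymm (hle hP hfix hP' hfix') (hle hP' hfix' hP hfix)

end Stability

section Existence

variable {N} {δ : Fin (s + 1) → ℕ} {d : ℕ} {K : ∀ i, Matrix (Fin n) (Fin (m i)) ℝ}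
  {P S L V Z : Matrix (Fin n) (Fin n) ℝ}

theorem IsControllable.eq_zero (hc : N.IsControllable) (hZ : 0 ≤ Z)
    (h : ∀ j, (N.Aᵀ) ^ j * Z * N.A ^ j * N.Q = 0) : Z = 0 := by
  have htrace : (Z * ∑ j ∈ Finset.range n, N.A ^ j * N.Q * (N.Aᵀ) ^ j).trace = 0 := by
    rw [Matrix.mul_sum, Matrix.trace_sum]
    refine Finset.sum_eq_zero fun j _ => ?_
    rw [← Matrix.mul_assoc, Matrix.trace_mul_comm, ← Matrix.mul_assoc, ← Matrix.mul_assoc, h j,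
      Matrix.trace_zero]
  rw [← Matrix.mul_one Z, ← posDef_mul_inv hc, ← Matrix.mul_assoc,
    mul_eq_zero_of_trace_eq_zero hZ hc.posSemidef.nonneg htrace, Matrix.zero_mul]

theorem IsControllable.eq_zero_of_invariant (hc : N.IsControllable)
    {p : Matrix (Fin n) (Fin n) ℝ → Prop}
    (hp : ∀ Z, 0 ≤ Z → p Z → Z * N.Q = 0 ∧ p (N.Aᵀ * Z * N.A)) (hZ : 0 ≤ Z) (hpZ : p Z) :
    Z = 0 := by
  have horbit (j : ℕ) : 0 ≤ (N.Aᵀ) ^ j * Z * N.A ^ j ∧ p ((N.Aᵀ) ^ j * Z * N.A ^ j) := by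
    induction j with
    | zero => simpa only [pow_zero, Matrix.one_mul, Matrix.mul_one] using ⟨hZ, hpZ⟩
    | succ j ih =>
      have hsucc : (N.Aᵀ) ^ (j + 1) * Z * N.A ^ (j + 1) =
          N.Aᵀ * ((N.Aᵀ) ^ j * Z * N.A ^ j) * N.A := by
        simp only [pow_succ' N.Aᵀ, pow_succ N.A, Matrix.mul_assoc]
      rw [hsucc]
      exact ⟨conj_transpose_nonneg ih.1 N.A, (hp _ ih.1 ih.2).2⟩
  exact hc.eq_zero hZ fun j => (hp _ (horbit j).1 (horbit j).2).1

theorem IsControllable.posDef_of_covStep_eq (hc : N.IsControllable) (hδ : ∀ i, 0 < δ i)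
    (hS : 0 ≤ S) (h : N.covStep δ K S = S) : S.PosDef := by
  refine posDef_of_trace_mul_eq_zero hS fun Z hZ hZS =>
    hc.eq_zero_of_invariant (p := fun Z => (Z * S).trace = 0) (fun Z hZ hZS => ?_) hZ hZS
  rw [← h, covStep_eq, Matrix.mul_add, Matrix.trace_add, add_eq_zero_iff_of_nonneg
    (trace_mul_nonneg hZ (N.propagate_nonneg S hS))
    (trace_mul_nonneg hZ (N.injectedNoise_nonneg hδ))] at hZS
  obtain ⟨hZQ, hZA⟩ := N.mul_eq_zero_of_trace_mul_injectedNoise hδ hZ hZS.2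
  exact ⟨hZQ, by rw [← N.propagateAdjoint_eq_of_mul_eq_zero hZ hZA, ← trace_mul_propagate, hZS.1]⟩

theorem IsControllable.kfStep_posDef (hc : N.IsControllable) (hδ : ∀ i, 0 < δ i)
    (hP : P.PosDef) : (N.kfStep δ d P).PosDef := by
  have hU := N.measUpdate_posDef (d := d) hδ hP
  refine posDef_of_trace_mul_eq_zero (N.kfStep_nonneg hδ hP) fun Z hZ hZP =>
    hc.eq_zero_of_invariant (p := fun Z => (Z * N.kfStep δ d P).trace = 0)
      (fun Z hZ hZP => ?_) hZ hZP
  rw [kfStep, timeUpdate, Matrix.mul_add, Matrix.trace_add, add_eq_zero_iff_of_nonneg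
    (trace_mul_nonneg hZ (conj_nonneg hU.posSemidef.nonneg N.A))
    (trace_mul_nonneg hZ N.Q_posSemidef.nonneg)] at hZP
  have hZA : Z * N.A = 0 := by
    rw [← Matrix.mul_one (Z * N.A), ← posDef_mul_inv hU, ← Matrix.mul_assoc,
      mul_mul_eq_zero_of_trace_eq_zero hZ hU.posSemidef.nonneg hZP.1, Matrix.zero_mul]
  refine ⟨mul_eq_zero_of_trace_eq_zero hZ N.Q_posSemidef.nonneg hZP.2, ?_⟩
  rw [Matrix.mul_assoc N.Aᵀ, hZA, Matrix.mul_zero, Matrix.zero_mul, Matrix.trace_zero]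

variable {ι : Type*} {f : Filter ι} {M : ι → Matrix (Fin n) (Fin n) ℝ}

theorem tendsto_covStep {Kt : ι → ∀ i, Matrix (Fin n) (Fin (m i)) ℝ} (hK : Tendsto Kt f (𝓝 K))
    (hM : Tendsto M f (𝓝 L)) :
    Tendsto (fun t => N.covStep δ (Kt t) (M t)) f (𝓝 (N.covStep δ K L)) := by
  have hcont : Continuous fun p : (∀ i, Matrix (Fin n) (Fin (m i)) ℝ) ×
      Matrix (Fin n) (Fin n) ℝ => N.covStep δ p.1 p.2 := by
    unfold covStep timeUpdate josephUpdate meanResidual inflatedNoise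
    fun_prop
  have hpair := (hcont.tendsto (K, L)).comp (hK.prodMk_nhds hM)
  simpa only [Function.comp_def] using hpair

theorem tendsto_inflatedNoise_inv (hδ : ∀ i, 0 < δ i) (hL : 0 ≤ L) (h : Tendsto M f (𝓝 L)) (i) :
    Tendsto (fun t => (N.inflatedNoise δ (M t) i)⁻¹) f (𝓝 (N.inflatedNoise δ L i)⁻¹) := by
  have hcont : Continuous fun M => N.inflatedNoise δ M i := by
    unfold inflatedNoise
    fun_prop
  exact tendsto_matrix_inv (N.inflatedNoise_posDef hδ hL i) ((hcont.tendsto L).comp h)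

theorem tendsto_kfStep (hδ : ∀ i, 0 < δ i) (hM : ∀ t, (M t).PosDef) (hL : L.PosDef)
    (h : Tendsto M f (𝓝 L)) :
    Tendsto (fun t => N.kfStep δ d (M t)) f (𝓝 (N.kfStep δ d L)) := by
  have htime : Continuous N.timeUpdate := by
    unfold timeUpdate
    fun_prop
  refine (htime.tendsto _).comp (tendsto_matrix_inv (N.posDef_inv_add_dataInfo hδ hL)
    ((tendsto_matrix_inv hL h).add ?_))
  simp only [N.dataInfo_eq hδ (hM _), N.dataInfo_eq hδ hL]
  refine tendsto_finsetSum _ fun i _ => ?_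
  have hcont : Continuous fun Y : Matrix (Fin (m i)) (Fin (m i)) ℝ =>
      N.lam i • ((N.C i)ᵀ * Y * N.C i) := by fun_prop
  exact (hcont.tendsto _).comp (tendsto_inflatedNoise_inv hδ hL.posSemidef.nonneg h i)

theorem exists_tendsto_activeKalmanGain (hδ : ∀ i, 0 < δ i) (hL : 0 ≤ L)
    (h : Tendsto M f (𝓝 L)) (hV : Tendsto (fun t => N.measUpdate δ d (M t)) f (𝓝 V)) :
    ∃ κ, Tendsto (fun t => N.activeKalmanGain δ d (M t)) f (𝓝 κ) := by
  have hgain (i) : ∃ κ, Tendsto (fun t => N.activeKalmanGain δ d (M t) i) f (𝓝 κ) := by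
    by_cases hi : i ∈ N.activeSensors δ d
    · have hcont : Continuous fun p : Matrix (Fin n) (Fin n) ℝ ×
          Matrix (Fin (m i)) (Fin (m i)) ℝ => p.1 * (N.C i)ᵀ * p.2 := by fun_prop
      have hactive (t) : N.activeKalmanGain δ d (M t) i =
          N.measUpdate δ d (M t) * (N.C i)ᵀ * (N.inflatedNoise δ (M t) i)⁻¹ := if_pos hi
      have hpair := (hcont.tendsto (V, (N.inflatedNoise δ L i)⁻¹)).comp
        (hV.prodMk_nhds (tendsto_inflatedNoise_inv hδ hL.posSemidef.nonneg h i))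
      exact ⟨_, by simpa only [Function.comp_def, ← hactive] using hpair⟩
    · exact ⟨0, by simp only [N.activeKalmanGain_of_notMem i hi, tendsto_const_nhds]⟩
  choose κ hκ using hgain
  exact ⟨κ, tendsto_pi_nhds.2 hκ⟩

theorem antitone_iterate_kfStep (hδ : ∀ i, 0 < δ i) (hpos : ∀ t, ((N.kfStep δ d)^[t] S).PosDef)
    (h : N.kfStep δ d S ≤ S) : Antitone fun t => (N.kfStep δ d)^[t] S := by
  refine antitone_nat_of_succ_le fun t => ?_
  induction t with
  | zero => exact h
  | succ t ih =>
    have hmono := N.kfStep_mono (d := d) hδ (hpos (t + 1)) ih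
    simpa only [← Function.iterate_succ_apply'] using hmono

theorem IsControllable.exists_kfStep_fixed (hc : N.IsControllable) (hδ : ∀ i, 0 < δ i)
    (hKd : ∀ i, i ∉ N.activeSensors δ d → K i = 0) (hS : 0 ≤ S) (h : N.covStep δ K S = S) :
    ∃ P : Matrix (Fin n) (Fin n) ℝ, P.PosDef ∧ N.kfStep δ d P = P := by
  set P : ℕ → Matrix (Fin n) (Fin n) ℝ := fun t => (N.kfStep δ d)^[t] S
  have hsucc (t) : P (t + 1) = N.kfStep δ d (P t) := Function.iterate_succ_apply' _ _ _
  have hSpos := hc.posDef_of_covStep_eq hδ hS h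
  have hP (t) : (P t).PosDef := by
    induction t with
    | zero => exact hSpos
    | succ t ih => rw [hsucc]; exact hc.kfStep_posDef hδ ih
  have hanti : Antitone P :=
    antitone_iterate_kfStep hδ hP ((N.kfStep_le_covStep hδ hSpos hKd).trans_eq h)
  obtain ⟨L, hL⟩ := exists_tendsto_of_antitone (fun t => (hP t).posSemidef.nonneg) hanti
  obtain ⟨V, hV⟩ := exists_tendsto_of_antitone
    (fun t => (N.measUpdate_posDef (d := d) hδ (hP t)).posSemidef.nonneg)
    (fun t u htu => N.measUpdate_mono hδ (hP u) (hanti htu))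
  have hLnonneg : 0 ≤ L := ge_of_tendsto' hL fun t => (hP t).posSemidef.nonneg
  have hshift : Tendsto (fun t => N.kfStep δ d (P t)) atTop (𝓝 L) := by
    simpa only [Function.comp_def, hsucc] using hL.comp (tendsto_add_atTop_nat 1)
  obtain ⟨κ, hκ⟩ := exists_tendsto_activeKalmanGain hδ hLnonneg hL hV
  have hfix : N.covStep δ κ L = L := by
    refine tendsto_nhds_unique ((tendsto_covStep hκ hL).congr fun t => ?_) hshift
    exact N.covStep_activeKalmanGain hδ (hP t)
  have hLpos : L.PosDef := hc.posDef_of_covStep_eq hδ hLnonneg hfix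
  exact ⟨L, hLpos, tendsto_nhds_unique (tendsto_kfStep hδ hP hLpos hL) hshift⟩

end Existence

section ConstantGainFilter

variable (δ : Fin (s + 1) → ℕ)

/-- The error covariance recursion with the gains `g t` at time `t`. -/
noncomputable def covRun (g : ℕ → ∀ i, Matrix (Fin n) (Fin (m i)) ℝ)
    (M : Matrix (Fin n) (Fin n) ℝ) : ℕ → Matrix (Fin n) (Fin n) ℝ
  | 0 => M
  | t + 1 => N.covStep δ (g t) (covRun g M t)

/-- The transient gains of a constant-gain filter for data of delay `d`, set to `0` for the sensors
without such data. -/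
noncomputable def activeTransientGain (G : ConstantGains n s m) (d : ℕ) (i : Fin (s + 1)) :
    Matrix (Fin n) (Fin (m i)) ℝ :=
  if i ∈ N.activeSensors δ d then G.transient d i else 0

/-- The counterpart of `kfMultiStep` for the transient gains of a constant-gain filter. -/
noncomputable def gainMultiStep (G : ConstantGains n s m) (b : ℕ) :
    ℕ → Matrix (Fin n) (Fin n) ℝ → Matrix (Fin n) (Fin n) ℝ
  | 0, M => M
  | j + 1, M => gainMultiStep G b j (N.covStep δ (N.activeTransientGain δ G (b + j)) M)

/-- The error covariance that the estimate of a constant-gain filter inherits from the error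
covariance `M` of its steady phase: the counterpart of `predictedCov`. -/
noncomputable def gainPredictedCov (G : ConstantGains n s m) (M : Matrix (Fin n) (Fin n) ℝ) :
    Matrix (Fin n) (Fin n) ℝ :=
  N.timeUpdate^[N.predLength δ]
    (N.gainMultiStep δ G (N.minDelay δ) (N.maxDelay δ - N.minDelay δ) M)

variable {N δ} {G : ConstantGains n s m} {P M M' : Matrix (Fin n) (Fin n) ℝ} {k t : ℕ}

theorem activeTransientGain_of_notMem {d : ℕ} (i) (hi : i ∉ N.activeSensors δ d) :
    N.activeTransientGain δ G d i = 0 :=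
  if_neg hi

theorem mem_activeSensors {d : ℕ} {i} : i ∈ N.activeSensors δ d ↔ N.totalDelay δ i ≤ d := by
  simp only [activeSensors, Finset.mem_filter, Finset.mem_univ, true_and]

theorem covRun_const (K : ∀ i, Matrix (Fin n) (Fin (m i)) ℝ) (t : ℕ) :
    N.covRun δ (fun _ => K) M t = (N.covStep δ K)^[t] M := by
  induction t with
  | zero => rfl
  | succ t ih => rw [covRun, ih, Function.iterate_succ_apply']

theorem covStep_zero : N.covStep δ 0 M = N.timeUpdate M := by
  simp only [covStep, josephUpdate, meanResidual, Pi.zero_apply, Matrix.zero_mul, smul_zero,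
    Finset.sum_const_zero, sub_zero, Matrix.one_mul, Matrix.transpose_one, Matrix.mul_one, add_zero]

theorem continuous_gainPredictedCov : Continuous (N.gainPredictedCov δ G) := by
  have htime : Continuous N.timeUpdate := by
    unfold timeUpdate
    fun_prop
  have hmulti (b j) : Continuous (N.gainMultiStep δ G b j) := by
    induction j with
    | zero => exact continuous_id
    | succ j ih =>
      exact ih.comp (continuous_iff_continuousAt.2 fun _ =>
        tendsto_covStep tendsto_const_nhds tendsto_id)
  exact (htime.iterate _).comp (hmulti _ _)

theorem gainSchedule_eq_activeTransientGain {d : ℕ} (ht : d + N.fusionDelay δ + t = k)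
    (hd : d < N.maxDelay δ) : N.gainSchedule δ G k t = N.activeTransientGain δ G d := by
  funext i
  have hkd : k - N.fusionDelay δ - t = d := by omega
  by_cases hi : N.totalDelay δ i ≤ d
  · rw [gainSchedule, if_pos (by omega), if_neg (by omega), hkd, activeTransientGain,
      if_pos (mem_activeSensors.2 hi)]
  · rw [gainSchedule, if_neg (by omega),
      activeTransientGain_of_notMem _ (mem_activeSensors.not.2 hi)]

theorem covRun_gainSchedule_transient {b q : ℕ} (hq : b + q ≤ N.maxDelay δ)
    (ht : t + N.fusionDelay δ + b + q = k + 1) :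
    N.covRun δ (N.gainSchedule δ G k) M (t + q) =
      N.gainMultiStep δ G b q (N.covRun δ (N.gainSchedule δ G k) M t) := by
  induction q generalizing t with
  | zero => rfl
  | succ q ih =>
    rw [gainMultiStep,
      ← gainSchedule_eq_activeTransientGain (k := k) (t := t) (by omega) (by omega), ← covRun,
      ← ih (by omega) (by omega), Nat.succ_add_eq_add_succ]

section Schedule

variable (hsorted : Monotone (N.totalDelay δ))

include hsorted

theorem minDelay_le_maxDelay : N.minDelay δ ≤ N.maxDelay δ := hsorted (Fin.zero_le _)

theorem mem_activeSensors_maxDelay (i) : i ∈ N.activeSensors δ (N.maxDelay δ) :=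
  mem_activeSensors.2 (hsorted (Fin.le_last i))

theorem kalmanGains_steady :
    (N.kalmanGains δ P).steady = N.activeKalmanGain δ (N.maxDelay δ) P :=
  funext fun i => (if_pos (mem_activeSensors_maxDelay hsorted i)).symm

theorem gainSchedule_eq_steady (ht : N.maxDelay δ + N.fusionDelay δ + t ≤ k) :
    N.gainSchedule δ G k t = G.steady := by
  funext i
  have hi : N.totalDelay δ i ≤ N.maxDelay δ := hsorted (Fin.le_last i)
  rw [gainSchedule, if_pos (by omega), if_pos (by omega)]

theorem gainSchedule_eq_zero (ht : k < N.minDelay δ + N.fusionDelay δ + t) :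
    N.gainSchedule δ G k t = 0 := by
  funext i
  have hi : N.minDelay δ ≤ N.totalDelay δ i := hsorted (Fin.zero_le i)
  rw [gainSchedule, if_neg (by omega), Pi.zero_apply]

theorem covRun_gainSchedule_steady {j : ℕ} (hj : N.maxDelay δ + N.fusionDelay δ + j ≤ k + 1) :
    N.covRun δ (N.gainSchedule δ G k) M j = (N.covStep δ G.steady)^[j] M := by
  induction j with
  | zero => rfl
  | succ j ih =>
    rw [covRun, ih (by omega), gainSchedule_eq_steady hsorted (by omega),
      Function.iterate_succ_apply']

theorem covRun_gainSchedule_predict (ht : k < N.minDelay δ + N.fusionDelay δ + t) (p : ℕ) :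
    N.covRun δ (N.gainSchedule δ G k) M (t + p) =
      N.timeUpdate^[p] (N.covRun δ (N.gainSchedule δ G k) M t) := by
  induction p with
  | zero => rfl
  | succ p ih =>
    rw [Function.iterate_succ_apply', ← ih, ← covStep_zero (δ := δ),
      ← gainSchedule_eq_zero (G := G) (k := k) (t := t + p) hsorted (by omega)]
    rfl

theorem covRun_gainSchedule (hδ : ∀ i, 0 < δ i) (j : ℕ)
    (hk : k = j + (N.maxDelay δ - 1 + N.fusionDelay δ)) :
    N.covRun δ (N.gainSchedule δ G k) M k =
      N.gainPredictedCov δ G ((N.covStep δ G.steady)^[j] M) := by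
  have hmin : 0 < N.minDelay δ := Nat.add_pos_left (hδ 0) _
  have hmm := minDelay_le_maxDelay hsorted
  have hsplit : k = j + (N.maxDelay δ - N.minDelay δ) + N.predLength δ := by
    rw [predLength]
    omega
  rw [gainPredictedCov, ← covRun_gainSchedule_steady (k := k) hsorted (by omega),
    ← covRun_gainSchedule_transient (by omega) (by omega),
    ← covRun_gainSchedule_predict hsorted (by omega), ← hsplit]

end Schedule

theorem kfMultiStep_succ (b j : ℕ) :
    N.kfMultiStep δ b (j + 1) P = N.kfStep δ b (N.kfMultiStep δ (b + 1) j P) := by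
  induction j generalizing P with
  | zero => rfl
  | succ j ih => rw [kfMultiStep, ih, kfMultiStep, Nat.add_assoc, Nat.add_comm 1 j]

section FixedPoint

variable {d : ℕ} (hδ : ∀ i, 0 < δ i) (hP : P.PosDef) (hfix : N.kfStep δ d P = P)

include hδ hP hfix

theorem le_kfStep {d' : ℕ} (hd : d' ≤ d) (hM : P ≤ M) : P ≤ N.kfStep δ d' M :=
  calc P = N.kfStep δ d P := hfix.symm
    _ ≤ N.kfStep δ d' P := N.kfStep_anti hδ hd hP
    _ ≤ N.kfStep δ d' M := N.kfStep_mono hδ hP hM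

theorem le_kfMultiStep {b j : ℕ} (hbj : b + j ≤ d) : P ≤ N.kfMultiStep δ b j P := by
  induction j generalizing b with
  | zero => exact le_rfl
  | succ j ih =>
    rw [kfMultiStep_succ]
    exact le_kfStep hδ hP hfix (by omega) (ih (by omega))

theorem kfMultiStep_le_gainMultiStep (G : ConstantGains n s m) {b j : ℕ} (hbj : b + j ≤ d)
    (hPM : P ≤ M) (hM : M ≤ M') : N.kfMultiStep δ b j M ≤ N.gainMultiStep δ G b j M' := by
  induction j generalizing M M' with
  | zero => exact hM
  | succ j ih =>
    refine ih (by omega) (le_kfStep hδ hP hfix (by omega) hPM) ?_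
    exact (N.kfStep_le_covStep hδ (posDef_of_le hP hPM) activeTransientGain_of_notMem).trans
      (N.covStep_mono hM)

end FixedPoint

section Kalman

variable (hδ : ∀ i, 0 < δ i) (hP : P.PosDef) (hfix : N.kfStep δ (N.maxDelay δ) P = P)

include hδ hP hfix

theorem gainMultiStep_kalmanGains {b q : ℕ} (hbq : b + q ≤ N.maxDelay δ) :
    N.gainMultiStep δ (N.kalmanGains δ P) b q
        (N.kfMultiStep δ (b + q) (N.maxDelay δ - (b + q)) P) =
      N.kfMultiStep δ b (N.maxDelay δ - b) P := by
  induction q with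
  | zero => rfl
  | succ q ih =>
    have hpos := posDef_of_le hP (le_kfMultiStep (b := b + q + 1)
      (j := N.maxDelay δ - (b + q + 1)) hδ hP hfix (by omega))
    have hlen : N.maxDelay δ - (b + q) = N.maxDelay δ - (b + q + 1) + 1 := by omega
    rw [← ih (by omega), gainMultiStep, hlen, kfMultiStep_succ,
      ← N.covStep_activeKalmanGain hδ hpos]
    rfl

variable (hsorted : Monotone (N.totalDelay δ))

include hsorted

theorem gainPredictedCov_kalmanGains :
    N.gainPredictedCov δ (N.kalmanGains δ P) P = N.predictedCov δ P := by
  have hmm := minDelay_le_maxDelay hsorted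
  have hmulti := gainMultiStep_kalmanGains (b := N.minDelay δ)
    (q := N.maxDelay δ - N.minDelay δ) hδ hP hfix (by omega)
  rw [Nat.add_sub_cancel' hmm, Nat.sub_self] at hmulti
  exact congrArg _ hmulti

theorem predictedCov_le_gainPredictedCov (G : ConstantGains n s m) (hPM : P ≤ M) :
    N.predictedCov δ P ≤ N.gainPredictedCov δ G M := by
  have hmm := minDelay_le_maxDelay hsorted
  exact N.timeUpdate_mono.iterate _
    (kfMultiStep_le_gainMultiStep hδ hP hfix G (by omega) le_rfl hPM)

end Kalman

end ConstantGainFilter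

namespace Realization

open SecondMoment

variable {N} {δ : Fin (s + 1) → ℕ} {Ω : Type*} [mΩ : MeasurableSpace Ω] {μ : Measure Ω}
  (X : Realization N δ μ)

section Sources

/-- The σ-algebra of a source of randomness. -/
@[reducible] def sourceAlg : NoiseSource s → MeasurableSpace Ω
  | .initial => MeasurableSpace.comap X.x0 inferInstance
  | .system k => MeasurableSpace.comap (X.w k) inferInstance
  | .sensor k i => MeasurableSpace.comap (X.v k i) inferInstance
  | .arrival k => ⨆ i, MeasurableSpace.comap (X.γ k i) inferInstance

/-- The σ-algebra of a set of sources of randomness. -/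
@[reducible] def sourcesAlg (A : Set (NoiseSource s)) : MeasurableSpace Ω :=
  ⨆ a ∈ A, X.sourceAlg a

/-- The sources of randomness that act before time `t`. -/
def sourcesBefore (t : ℕ) : Set (NoiseSource s) :=
  {a | match a with
    | .initial => True
    | .system k => k < t
    | .sensor k _ => k < t
    | .arrival k => k < t}

variable {A B : Set (NoiseSource s)} {k t : ℕ} {i : Fin (s + 1)}

theorem sourcesBefore_mono : sourcesBefore (s := s) t ⊆ sourcesBefore (t + 1) := by
  rintro (_ | k | ⟨k, i⟩ | k) h
  · trivial
  all_goals exact Nat.lt_succ_of_lt h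

theorem sourcesBefore_subset_compl_system :
    sourcesBefore t ⊆ ({NoiseSource.system t}ᶜ : Set (NoiseSource s)) := by
  rintro _ h rfl
  exact lt_irrefl t h

theorem sourcesBefore_subset_compl_arrival :
    sourcesBefore t ⊆ ({NoiseSource.arrival t}ᶜ : Set (NoiseSource s)) := by
  rintro _ h rfl
  exact lt_irrefl t h

theorem sourceAlg_le (a : NoiseSource s) : X.sourceAlg a ≤ mΩ := by
  cases a with
  | initial => exact X.x0_measurable.comap_le
  | system k => exact (X.w_measurable k).comap_le
  | sensor k i => exact (X.v_measurable k i).comap_le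
  | arrival k => exact iSup_le fun i => (X.γ_measurable k i).comap_le

theorem sourcesAlg_le (A : Set (NoiseSource s)) : X.sourcesAlg A ≤ mΩ :=
  iSup₂_le fun a _ => X.sourceAlg_le a

theorem sourcesAlg_mono (h : A ⊆ B) : X.sourcesAlg A ≤ X.sourcesAlg B :=
  biSup_mono h

theorem indep_sourcesAlg (h : Disjoint A B) : Indep (X.sourcesAlg A) (X.sourcesAlg B) μ :=
  indep_iSup_of_disjoint X.sourceAlg_le X.indep h

theorem sourceAlg_le_sourcesAlg {a : NoiseSource s} (ha : a ∈ A) :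
    X.sourceAlg a ≤ X.sourcesAlg A :=
  le_iSup₂_of_le a ha le_rfl

theorem measurable_x0 (h : NoiseSource.initial ∈ A) : Measurable[X.sourcesAlg A] X.x0 :=
  measurable_iff_comap_le.2 (X.sourceAlg_le_sourcesAlg h)

theorem measurable_w (h : NoiseSource.system k ∈ A) : Measurable[X.sourcesAlg A] (X.w k) :=
  measurable_iff_comap_le.2 (X.sourceAlg_le_sourcesAlg h)

theorem measurable_v (h : NoiseSource.sensor k i ∈ A) : Measurable[X.sourcesAlg A] (X.v k i) :=
  measurable_iff_comap_le.2 (X.sourceAlg_le_sourcesAlg h)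

theorem measurable_γ (h : NoiseSource.arrival k ∈ A) (i) : Measurable[X.sourcesAlg A] (X.γ k i) :=
  measurable_iff_comap_le.2 ((le_iSup
    (fun i => MeasurableSpace.comap (X.γ k i) (inferInstance : MeasurableSpace ℝ)) i).trans
      (X.sourceAlg_le_sourcesAlg h))

theorem integral_mul_of_disjoint (h : Disjoint A B) {f g : Ω → ℝ}
    (hf : Measurable[X.sourcesAlg A] f) (hg : Measurable[X.sourcesAlg B] g) :
    ∫ ω, f ω * g ω ∂μ = (∫ ω, f ω ∂μ) * ∫ ω, g ω ∂μ := by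
  have hind : IndepFun f g μ := (IndepFun_iff_Indep f g μ).2
    (indep_of_indep_of_le_left (indep_of_indep_of_le_right (X.indep_sourcesAlg h)
      (measurable_iff_comap_le.1 hg)) (measurable_iff_comap_le.1 hf))
  exact hind.integral_fun_mul_eq_mul_integral
    (hf.mono (X.sourcesAlg_le A) le_rfl).aestronglyMeasurable
    (hg.mono (X.sourcesAlg_le B) le_rfl).aestronglyMeasurable

variable {p q : Type*} {e : Ω → p → ℝ} {f : Ω → q → ℝ}

theorem crossMoment_eq_zero_of_disjoint (h : Disjoint A B) (he : Measurable[X.sourcesAlg A] e)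
    (hf : Measurable[X.sourcesAlg B] f) (hf0 : ∀ b, ∫ ω, f ω b ∂μ = 0) :
    crossMoment μ e f = 0 := by
  ext a b
  rw [crossMoment_apply, X.integral_mul_of_disjoint h (f := fun ω => e ω a) (g := fun ω => f ω b)
    ((measurable_pi_apply a).comp he) ((measurable_pi_apply b).comp hf), hf0, mul_zero,
    Matrix.zero_apply]

theorem crossMoment_smul_smul_of_disjoint (h : Disjoint A B) {φ ψ : Ω → ℝ}
    (hφ : Measurable[X.sourcesAlg A] φ) (hψ : Measurable[X.sourcesAlg A] ψ)
    (he : Measurable[X.sourcesAlg B] e) (hf : Measurable[X.sourcesAlg B] f) :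
    crossMoment μ (fun ω => φ ω • e ω) (fun ω => ψ ω • f ω) =
      (∫ ω, φ ω * ψ ω ∂μ) • crossMoment μ e f := by
  ext a b
  rw [Matrix.smul_apply, smul_eq_mul, crossMoment_apply, crossMoment_apply,
    ← X.integral_mul_of_disjoint h (f := fun ω => φ ω * ψ ω) (g := fun ω => e ω a * f ω b)
      (hφ.mul hψ) (((measurable_pi_apply a).comp he).mul ((measurable_pi_apply b).comp hf))]
  simp only [Pi.smul_apply, smul_eq_mul, mul_mul_mul_comm]

end Sources

section Arrivals

theorem norm_γ_le_one (k i ω) : ‖X.γ k i ω‖ ≤ 1 := by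
  rcases X.γ_binary k i ω with h | h <;> simp [h]

theorem integral_γ (k i) : ∫ ω, X.γ k i ω ∂μ = N.lam i := by
  have hs : MeasurableSet {ω | X.γ k i ω = 1} := X.γ_measurable k i (measurableSet_singleton 1)
  rw [← X.γ_prob k i, ← integral_indicator_one hs]
  refine integral_congr_ae (Eventually.of_forall fun ω => ?_)
  rcases X.γ_binary k i ω with h | h <;> simp [Set.indicator, h]

theorem integral_γ_mul_self (k i) : ∫ ω, X.γ k i ω * X.γ k i ω ∂μ = N.lam i := by
  rw [← X.integral_γ k i]
  refine integral_congr_ae (Eventually.of_forall fun ω => ?_)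
  rcases X.γ_binary k i ω with h | h <;> simp [h]

theorem integral_γ_mul [IsProbabilityMeasure μ] (k) {i j} (hij : i ≠ j) :
    ∫ ω, X.γ k i ω * X.γ k j ω ∂μ = N.lam i * N.lam j := by
  have hL (i) : MemLp (X.γ k i) 2 μ := MemLp.of_bound (X.γ_measurable k i).aestronglyMeasurable 1
    (Eventually.of_forall (X.norm_γ_le_one k i))
  have hcov := covariance_eq_sub (hL i) (hL j)
  rw [X.γ_uncorrelated k i j hij, X.integral_γ, X.integral_γ] at hcov
  exact sub_eq_zero.1 hcov.symm

end Arrivals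

section ErrorDynamics

/-- The correction of the prediction error `e` by the measurement of sensor `i` at time `t`, if that
measurement is received. -/
def correction (K : ∀ i, Matrix (Fin n) (Fin (m i)) ℝ) (t : ℕ) (e : Ω → Fin n → ℝ)
    (i : Fin (s + 1)) (ω : Ω) : Fin n → ℝ :=
  K i *ᵥ (N.C i *ᵥ e ω + X.v t i ω)

/-- The error left by the measurement update at time `t` of the prediction error `e`. -/
def filteredError (K : ∀ i, Matrix (Fin n) (Fin (m i)) ℝ) (t : ℕ) (e : Ω → Fin n → ℝ) (ω : Ω) :
    Fin n → ℝ :=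
  e ω - ∑ i, X.γ t i ω • X.correction K t e i ω

/-- The prediction error of the filter with gains `g`, started from the estimate `c`. -/
def errorRun (g : ℕ → ∀ i, Matrix (Fin n) (Fin (m i)) ℝ) (c : Fin n → ℝ) : ℕ → Ω → Fin n → ℝ
  | 0 => fun ω => X.x0 ω - c
  | t + 1 => fun ω => N.A *ᵥ X.filteredError (g t) t (errorRun g c t) ω + X.w t ω

variable (K : ∀ i, Matrix (Fin n) (Fin (m i)) ℝ) (g : ℕ → ∀ i, Matrix (Fin n) (Fin (m i)) ℝ)
  (c : Fin n → ℝ) {A : Set (NoiseSource s)} {t : ℕ} {e : Ω → Fin n → ℝ}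

theorem state_sub_filterRun (t : ℕ) (ω : Ω) :
    X.state t ω - X.filterRun g c t ω = X.errorRun g c t ω := by
  induction t with
  | zero => rfl
  | succ t ih =>
    have hcorr (i) : g t i *ᵥ (X.meas t i ω - N.C i *ᵥ X.filterRun g c t ω) =
        X.correction (g t) t (X.errorRun g c t) i ω := by
      rw [correction, ← ih, Matrix.mulVec_sub (N.C i), meas, add_sub_right_comm]
    simp only [state, filterRun, errorRun, filteredError, hcorr]
    rw [← ih]
    simp only [Matrix.mulVec_sub, Matrix.mulVec_add]
    abel

theorem measurable_correction (he : Measurable[X.sourcesAlg A] e) {i}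
    (hi : NoiseSource.sensor t i ∈ A) : Measurable[X.sourcesAlg A] (X.correction K t e i) :=
  measurable_mulVec _ ((measurable_mulVec _ he).add (X.measurable_v hi))

theorem measurable_filteredError (he : Measurable[X.sourcesAlg A] e)
    (hγ : NoiseSource.arrival t ∈ A) (hv : ∀ i, NoiseSource.sensor t i ∈ A) :
    Measurable[X.sourcesAlg A] (X.filteredError K t e) :=
  he.sub (Finset.measurable_fun_sum _ fun i _ =>
    (X.measurable_γ hγ i).smul (X.measurable_correction K he (hv i)))

theorem measurable_errorRun (t : ℕ) :
    Measurable[X.sourcesAlg (sourcesBefore t)] (X.errorRun g c t) := by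
  induction t with
  | zero => exact (X.measurable_x0 (A := sourcesBefore 0) trivial).sub measurable_const
  | succ t ih =>
    have hlt : t < t + 1 := Nat.lt_succ_self t
    have hfilt := X.measurable_filteredError (g t) (A := sourcesBefore (t + 1))
      (ih.mono (X.sourcesAlg_mono sourcesBefore_mono) le_rfl) (t := t) hlt fun _ => hlt
    exact (measurable_mulVec N.A hfilt).add (X.measurable_w (A := sourcesBefore (t + 1)) hlt)

theorem memLp_w (k) : MemLp (X.w k) 2 μ := memLp_of_hasLaw (X.w_measurable k) (X.w_law k)

theorem memLp_v (k i) : MemLp (X.v k i) 2 μ := memLp_of_hasLaw (X.v_measurable k i) (X.v_law k i)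

theorem memLp_innovation (he : MemLp e 2 μ) (i) :
    MemLp (fun ω => N.C i *ᵥ e ω + X.v t i ω) 2 μ :=
  have hCe : MemLp (fun ω => N.C i *ᵥ e ω) 2 μ := memLp_mulVec _ he
  hCe.add (X.memLp_v t i)

theorem memLp_correction (he : MemLp e 2 μ) (i) : MemLp (X.correction K t e i) 2 μ :=
  memLp_mulVec _ (X.memLp_innovation he i)

theorem memLp_γ_smul_correction (he : MemLp e 2 μ) (i) :
    MemLp (fun ω => X.γ t i ω • X.correction K t e i ω) 2 μ :=
  memLp_binary_smul (X.γ_measurable t i) (X.γ_binary t i) (X.memLp_correction K he i)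

theorem memLp_filteredError (he : MemLp e 2 μ) : MemLp (X.filteredError K t e) 2 μ :=
  he.sub (memLp_finsetSum _ fun i _ => X.memLp_γ_smul_correction K he i)

theorem memLp_errorRun [IsProbabilityMeasure μ] (t : ℕ) : MemLp (X.errorRun g c t) 2 μ := by
  induction t with
  | zero => exact X.x0_memLp.sub (memLp_const c)
  | succ t ih =>
    have hfilt : MemLp (fun ω => N.A *ᵥ X.filteredError (g t) t (X.errorRun g c t) ω) 2 μ :=
      memLp_mulVec _ (X.memLp_filteredError _ ih)
    exact hfilt.add (X.memLp_w t)

end ErrorDynamics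

section Moments

variable (K : ∀ i, Matrix (Fin n) (Fin (m i)) ℝ) {t : ℕ} {e : Ω → Fin n → ℝ}
  (he : Measurable[X.sourcesAlg (sourcesBefore t)] e) (heL : MemLp e 2 μ)

theorem crossMoment_v_of_ne {i j} (hij : i ≠ j) : crossMoment μ (X.v t i) (X.v t j) = 0 :=
  X.crossMoment_eq_zero_of_disjoint (A := {NoiseSource.sensor t i})
    (B := {NoiseSource.sensor t j}) (by simpa using hij) (X.measurable_v (Set.mem_singleton _))
    (X.measurable_v (Set.mem_singleton _)) (integral_of_hasLaw (X.v_law t j))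

include he

theorem crossMoment_v (i) : crossMoment μ e (X.v t i) = 0 :=
  X.crossMoment_eq_zero_of_disjoint (B := {NoiseSource.sensor t i}) (by simp [sourcesBefore]) he
    (X.measurable_v (Set.mem_singleton _)) (integral_of_hasLaw (X.v_law t i))

theorem measurable_compl_arrival : Measurable[X.sourcesAlg {NoiseSource.arrival t}ᶜ] e :=
  he.mono (X.sourcesAlg_mono sourcesBefore_subset_compl_arrival) le_rfl

include heL

theorem crossMoment_correction (i) :
    crossMoment μ e (X.correction K t e i) = crossMoment μ e e * (K i * N.C i)ᵀ := by
  change crossMoment μ e (fun ω => K i *ᵥ (N.C i *ᵥ e ω + X.v t i ω)) = _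
  rw [crossMoment_mulVec_right _ heL (X.memLp_innovation heL i),
    crossMoment_add_right heL (memLp_mulVec _ heL) (X.memLp_v t i), X.crossMoment_v he, add_zero,
    crossMoment_mulVec_right _ heL heL, Matrix.transpose_mul, Matrix.mul_assoc]

theorem crossMoment_innovation_innovation (i j) :
    crossMoment μ (fun ω => N.C i *ᵥ e ω + X.v t i ω) (fun ω => N.C j *ᵥ e ω + X.v t j ω) =
      N.C i * crossMoment μ e e * (N.C j)ᵀ + crossMoment μ (X.v t i) (X.v t j) := by
  have hCe (i) : MemLp (fun ω => N.C i *ᵥ e ω) 2 μ := memLp_mulVec _ heL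
  have hve : crossMoment μ (X.v t i) e = 0 := by
    rw [← crossMoment_transpose, X.crossMoment_v he, Matrix.transpose_zero]
  rw [crossMoment_add_left (hCe i) (X.memLp_v t i) (X.memLp_innovation heL j),
    crossMoment_add_right (hCe i) (hCe j) (X.memLp_v t j),
    crossMoment_add_right (X.memLp_v t i) (hCe j) (X.memLp_v t j),
    crossMoment_mulVec_left _ heL (hCe j), crossMoment_mulVec_left _ heL (X.memLp_v t j),
    crossMoment_mulVec_right _ heL heL, crossMoment_mulVec_right _ (X.memLp_v t i) heL,
    X.crossMoment_v he, hve, Matrix.mul_zero, Matrix.zero_mul, add_zero, zero_add, Matrix.mul_assoc]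

theorem crossMoment_correction_correction (i j) :
    crossMoment μ (X.correction K t e i) (X.correction K t e j) =
      (K i * N.C i) * crossMoment μ e e * (K j * N.C j)ᵀ +
        K i * crossMoment μ (X.v t i) (X.v t j) * (K j)ᵀ := by
  have hcorr : MemLp (fun ω => K j *ᵥ (N.C j *ᵥ e ω + X.v t j ω)) 2 μ :=
    X.memLp_correction K heL j
  change crossMoment μ (fun ω => K i *ᵥ (N.C i *ᵥ e ω + X.v t i ω))
    (fun ω => K j *ᵥ (N.C j *ᵥ e ω + X.v t j ω)) = _
  rw [crossMoment_mulVec_left _ (X.memLp_innovation heL i) hcorr,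
    crossMoment_mulVec_right _ (X.memLp_innovation heL i) (X.memLp_innovation heL j),
    X.crossMoment_innovation_innovation he heL]
  simp only [Matrix.mul_add, Matrix.add_mul, Matrix.transpose_mul, Matrix.mul_assoc]

theorem crossMoment_γ_smul_correction (i) :
    crossMoment μ e (fun ω => X.γ t i ω • X.correction K t e i ω) =
      N.lam i • (crossMoment μ e e * (K i * N.C i)ᵀ) := by
  have he' := X.measurable_compl_arrival he
  have hmoment := X.crossMoment_smul_smul_of_disjoint (A := {NoiseSource.arrival t})
    (φ := fun _ => 1) (f := X.correction K t e i) disjoint_compl_right measurable_const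
    (X.measurable_γ (Set.mem_singleton _) i) he' (X.measurable_correction K he' (by simp))
  simpa only [one_smul, one_mul, X.integral_γ, X.crossMoment_correction K he heL] using hmoment

theorem crossMoment_γ_smul_correction_γ_smul_correction [IsProbabilityMeasure μ]
    (hδ : ∀ i, 0 < δ i) (i j) :
    crossMoment μ (fun ω => X.γ t i ω • X.correction K t e i ω)
        (fun ω => X.γ t j ω • X.correction K t e j ω) =
      (N.lam i * N.lam j) • ((K i * N.C i) * crossMoment μ e e * (K j * N.C j)ᵀ) +
        if i = j then N.lam i • (K i * N.inflatedNoise δ (crossMoment μ e e) i * (K i)ᵀ)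
        else 0 := by
  have he' := X.measurable_compl_arrival he
  rw [X.crossMoment_smul_smul_of_disjoint (A := {NoiseSource.arrival t}) disjoint_compl_right
    (X.measurable_γ (Set.mem_singleton _) i) (X.measurable_γ (Set.mem_singleton _) j)
    (X.measurable_correction K he' (by simp)) (X.measurable_correction K he' (by simp)),
    X.crossMoment_correction_correction K he heL]
  split_ifs with hij
  · subst hij
    rw [X.integral_γ_mul_self, crossMoment_of_hasLaw (X.v_measurable t i)
      (N.R_posDef i _ (hδ i)).posSemidef (X.v_law t i)]
    simp only [inflatedNoise, Matrix.mul_add, Matrix.add_mul, Matrix.mul_smul, Matrix.smul_mul,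
      Matrix.transpose_mul, Matrix.mul_assoc]
    module
  · rw [X.integral_γ_mul t hij, X.crossMoment_v_of_ne hij, Matrix.mul_zero, Matrix.zero_mul,
      add_zero, add_zero]

theorem crossMoment_filteredError [IsProbabilityMeasure μ] (hδ : ∀ i, 0 < δ i) :
    crossMoment μ (X.filteredError K t e) (X.filteredError K t e) =
      N.josephUpdate δ K (crossMoment μ e e) := by
  set u : Fin (s + 1) → Ω → Fin n → ℝ := fun i ω => X.γ t i ω • X.correction K t e i ω
  have hu (i) : MemLp (u i) 2 μ := X.memLp_γ_smul_correction K heL i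
  have hsum : MemLp (fun ω => ∑ i, u i ω) 2 μ := memLp_finsetSum _ fun i _ => hu i
  have hres : MemLp (fun ω => e ω - ∑ i, u i ω) 2 μ := heL.sub hsum
  have heu (i) : crossMoment μ e (u i) = N.lam i • (crossMoment μ e e * (K i * N.C i)ᵀ) :=
    X.crossMoment_γ_smul_correction K he heL i
  have hue (i) : crossMoment μ (u i) e = N.lam i • (crossMoment μ e e * (K i * N.C i)ᵀ)ᵀ := by
    rw [← crossMoment_transpose, heu, Matrix.transpose_smul]
  change crossMoment μ (fun ω => e ω - ∑ i, u i ω) (fun ω => e ω - ∑ i, u i ω) = _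
  rw [N.josephUpdate_eq_sub_sub_add (crossMoment_transpose e e),
    crossMoment_sub_left heL hsum hres, crossMoment_sub_right heL heL hsum,
    crossMoment_sub_right hsum heL hsum, crossMoment_sum_right _ heL hu,
    crossMoment_sum_left _ hu heL, crossMoment_sum_left _ hu hsum]
  simp only [crossMoment_sum_right _ (hu _) hu, heu, hue,
    ← X.crossMoment_γ_smul_correction_γ_smul_correction K he heL hδ]
  simp only [u]
  abel

end Moments

theorem crossMoment_errorRun_succ [IsProbabilityMeasure μ] (hδ : ∀ i, 0 < δ i)
    (g : ℕ → ∀ i, Matrix (Fin n) (Fin (m i)) ℝ) (c : Fin n → ℝ) (t : ℕ) :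
    crossMoment μ (X.errorRun g c (t + 1)) (X.errorRun g c (t + 1)) =
      N.covStep δ (g t) (crossMoment μ (X.errorRun g c t) (X.errorRun g c t)) := by
  have heL := X.memLp_errorRun g c t
  set y := X.filteredError (g t) t (X.errorRun g c t)
  have hyL : MemLp y 2 μ := X.memLp_filteredError (g t) heL
  have hAyL : MemLp (fun ω => N.A *ᵥ y ω) 2 μ := memLp_mulVec _ hyL
  have hy : Measurable[X.sourcesAlg {NoiseSource.system t}ᶜ] y :=
    X.measurable_filteredError (g t) ((X.measurable_errorRun g c t).mono
      (X.sourcesAlg_mono sourcesBefore_subset_compl_system) le_rfl) (by simp) (by simp)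
  have hyw : crossMoment μ (fun ω => N.A *ᵥ y ω) (X.w t) = 0 :=
    X.crossMoment_eq_zero_of_disjoint disjoint_compl_left (measurable_mulVec _ hy)
      (X.measurable_w (Set.mem_singleton _)) (integral_of_hasLaw (X.w_law t))
  change crossMoment μ (fun ω => N.A *ᵥ y ω + X.w t ω) (fun ω => N.A *ᵥ y ω + X.w t ω) = _
  rw [crossMoment_add_self_of_eq_zero hAyL (X.memLp_w t) hyw, crossMoment_mulVec_left _ hyL hAyL,
    crossMoment_mulVec_right _ hyL hyL,
    X.crossMoment_filteredError (g t) (X.measurable_errorRun g c t) heL hδ,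
    crossMoment_of_hasLaw (X.w_measurable t) N.Q_posSemidef (X.w_law t), covStep, timeUpdate,
    Matrix.mul_assoc]

section Conditioning

theorem arrivals_le_sourcesAlg : X.arrivals ≤ X.sourcesAlg (Set.range NoiseSource.arrival) :=
  iSup₂_le fun k i => measurable_iff_comap_le.1 (X.measurable_γ (Set.mem_range_self k) i)

theorem arrivals_le : X.arrivals ≤ mΩ := X.arrivals_le_sourcesAlg.trans (X.sourcesAlg_le _)

theorem measurable_γ_arrivals (k i) : Measurable[X.arrivals] (X.γ k i) :=
  measurable_iff_comap_le.2 (le_iSup₂_of_le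
    (f := fun k i => MeasurableSpace.comap (X.γ k i) (inferInstance : MeasurableSpace ℝ))
    k i le_rfl)

variable (g : ℕ → ∀ i, Matrix (Fin n) (Fin (m i)) ℝ) (c c' : Fin n → ℝ)

/-- The contribution to the prediction error at each time of an initial error `h`. -/
def biasRun (h : Fin n → ℝ) : ℕ → Ω → Fin n → ℝ
  | 0, _ => h
  | t + 1, ω => N.A *ᵥ (biasRun h t ω -
      ∑ i, X.γ t i ω • (g t i *ᵥ (N.C i *ᵥ biasRun h t ω)))

theorem errorRun_eq_add_biasRun (t : ℕ) (ω : Ω) :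
    X.errorRun g c t ω = X.errorRun g c' t ω + X.biasRun g (c' - c) t ω := by
  induction t with
  | zero => simp only [errorRun, biasRun, sub_add_sub_cancel]
  | succ t ih =>
    simp only [errorRun, filteredError, correction, biasRun, ih, Matrix.mulVec_add,
      Matrix.mulVec_sub, smul_add, Finset.sum_add_distrib]
    abel

theorem measurable_biasRun (t : ℕ) : Measurable[X.arrivals] (X.biasRun g c t) := by
  induction t with
  | zero => exact measurable_const
  | succ t ih =>
    exact measurable_mulVec _ (ih.sub (Finset.measurable_fun_sum _ fun i _ =>
      (X.measurable_γ_arrivals t i).smul (measurable_mulVec _ (measurable_mulVec _ ih))))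

variable [IsProbabilityMeasure μ]

theorem condCentered_of_disjoint {p : Type*} [Fintype p] {A : Set (NoiseSource s)}
    (hA : Disjoint A (Set.range NoiseSource.arrival)) {f : Ω → p → ℝ}
    (hf : Measurable[X.sourcesAlg A] f) (hfL : MemLp f 2 μ) (h0 : ∀ a, ∫ ω, f ω a ∂μ = 0) :
    CondCentered X.arrivals μ f := by
  have hint : Integrable f μ := hfL.integrable one_le_two
  have hind : Indep (X.sourcesAlg A) X.arrivals μ :=
    indep_of_indep_of_le_right (X.indep_sourcesAlg hA) X.arrivals_le_sourcesAlg
  refine CondCentered.of_indep (X.sourcesAlg_le A) X.arrivals_le hind hf.stronglyMeasurable hint ?_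
  funext a
  rw [eval_integral fun b => (hfL.eval b).integrable one_le_two, h0, Pi.zero_apply]

/-- Mean of the initial state. -/
noncomputable def initialMean : Fin n → ℝ := fun a => ∫ ω, X.x0 ω a ∂μ

theorem memLp_x0_sub_initialMean : MemLp (fun ω => X.x0 ω - X.initialMean) 2 μ :=
  X.x0_memLp.sub (memLp_const _)

theorem integral_x0_sub_initialMean (a) : ∫ ω, (X.x0 ω - X.initialMean) a ∂μ = 0 := by
  have hint : Integrable (fun ω => X.x0 ω a) μ := (X.x0_memLp.eval a).integrable one_le_two
  simp only [Pi.sub_apply]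
  rw [integral_sub hint (integrable_const _), integral_const, probReal_univ, one_smul,
    initialMean, sub_self]

theorem condCentered_errorRun (t : ℕ) :
    CondCentered X.arrivals μ (X.errorRun g X.initialMean t) := by
  induction t with
  | zero =>
    exact X.condCentered_of_disjoint (A := {NoiseSource.initial}) (by simp)
      ((X.measurable_x0 (Set.mem_singleton _)).sub measurable_const) X.memLp_x0_sub_initialMean
      X.integral_x0_sub_initialMean
  | succ t ih =>
    have hw : CondCentered X.arrivals μ (X.w t) :=
      X.condCentered_of_disjoint (A := {NoiseSource.system t}) (by simp)
        (X.measurable_w (Set.mem_singleton _)) (X.memLp_w t) (integral_of_hasLaw (X.w_law t))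
    have hv (i) : CondCentered X.arrivals μ (X.v t i) :=
      X.condCentered_of_disjoint (A := {NoiseSource.sensor t i}) (by simp)
        (X.measurable_v (Set.mem_singleton _)) (X.memLp_v t i) (integral_of_hasLaw (X.v_law t i))
    have hcorr (i) :
        CondCentered X.arrivals μ (X.correction (g t) t (X.errorRun g X.initialMean t) i) :=
      ((ih.mulVec _).add (hv i)).mulVec _
    exact ((ih.sub (CondCentered.sum _ fun i => (hcorr i).smul X.arrivals_le
      (X.measurable_γ_arrivals t i) (X.norm_γ_le_one t i))).mulVec _).add hw

theorem expectedCov_add {f b : Ω → Fin n → ℝ} (hf : CondCentered X.arrivals μ f)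
    (hb : Measurable[X.arrivals] b) (hint : Integrable b μ) :
    X.expectedCov (fun ω => f ω + b ω) = crossMoment μ f f := by
  have hmean (a) : μ[fun ω => f ω a + b ω a | X.arrivals] =ᵐ[μ] fun ω => b ω a :=
    (hf.map (ContinuousLinearMap.proj (R := ℝ) a)).condExp_add_eq X.arrivals_le
      ((measurable_pi_apply a).comp hb).stronglyMeasurable (hint.eval a)
  ext a a'
  rw [expectedCov, Matrix.of_apply, integral_condExp X.arrivals_le, crossMoment_apply]
  refine integral_congr_ae ?_
  filter_upwards [hmean a, hmean a'] with ω ha ha'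
  simp only [Pi.add_apply, ha, ha', add_sub_cancel_right]

theorem expectedCov_errorRun (t : ℕ) :
    X.expectedCov (X.errorRun g c t) =
      crossMoment μ (X.errorRun g X.initialMean t) (X.errorRun g X.initialMean t) := by
  have hsplit : X.errorRun g c t = fun ω =>
      X.errorRun g X.initialMean t ω + X.biasRun g (X.initialMean - c) t ω :=
    funext (X.errorRun_eq_add_biasRun g c X.initialMean t)
  have hcentered := X.condCentered_errorRun g t
  have hint : Integrable (X.biasRun g (X.initialMean - c) t) μ := by
    have hsub := ((X.memLp_errorRun g c t).integrable one_le_two).sub hcentered.integrable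
    refine hsub.congr (Eventually.of_forall fun ω => ?_)
    rw [Pi.sub_apply, X.errorRun_eq_add_biasRun g c X.initialMean t ω, add_sub_cancel_left]
  rw [hsplit]
  exact X.expectedCov_add hcentered (X.measurable_biasRun g _ t) hint

/-- Covariance matrix of the initial state. -/
noncomputable def initialCov : Matrix (Fin n) (Fin n) ℝ :=
  crossMoment μ (fun ω => X.x0 ω - X.initialMean) (fun ω => X.x0 ω - X.initialMean)

theorem initialCov_nonneg : 0 ≤ X.initialCov :=
  crossMoment_self_nonneg X.memLp_x0_sub_initialMean

theorem crossMoment_x0_sub :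
    crossMoment μ (fun ω => X.x0 ω - c) (fun ω => X.x0 ω - c) =
      X.initialCov + vecMulVec (X.initialMean - c) (X.initialMean - c) := by
  have hsplit : (fun ω => X.x0 ω - c) =
      fun ω => (X.x0 ω - X.initialMean) + (X.initialMean - c) :=
    funext fun ω => (sub_add_sub_cancel _ _ _).symm
  rw [hsplit, crossMoment_add_self_of_eq_zero X.memLp_x0_sub_initialMean (memLp_const _)
    (crossMoment_const_right X.integral_x0_sub_initialMean _), crossMoment_const_const, initialCov]

end Conditioning

section SteadyState

variable {X} [IsProbabilityMeasure μ] (hδ : ∀ i, 0 < δ i)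
  {K : ∀ i, Matrix (Fin n) (Fin (m i)) ℝ} {G : ConstantGains n s m}
  {P S : Matrix (Fin n) (Fin n) ℝ}

include hδ

theorem crossMoment_errorRun (g : ℕ → ∀ i, Matrix (Fin n) (Fin (m i)) ℝ) (c : Fin n → ℝ) (t : ℕ) :
    crossMoment μ (X.errorRun g c t) (X.errorRun g c t) =
      N.covRun δ g (X.initialCov + vecMulVec (X.initialMean - c) (X.initialMean - c)) t := by
  induction t with
  | zero => exact X.crossMoment_x0_sub c
  | succ t ih => rw [X.crossMoment_errorRun_succ hδ, ih, covRun]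

theorem predictorMSE_eq (c : Fin n → ℝ) (t : ℕ) :
    X.predictorMSE K c t = (N.covStep δ K)^[t]
      (X.initialCov + vecMulVec (X.initialMean - c) (X.initialMean - c)) := by
  rw [← covRun_const, ← crossMoment_errorRun hδ]
  ext a b
  simp only [predictorMSE, Matrix.of_apply, crossMoment_apply, ← X.state_sub_filterRun,
    Pi.sub_apply]

theorem errorCov_eq (c : Fin n → ℝ) (k : ℕ) :
    X.errorCov G c k = N.covRun δ (N.gainSchedule δ G k) X.initialCov k := by
  have herr : (fun ω => X.state k ω - X.estimate G c k ω) =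
      X.errorRun (N.gainSchedule δ G k) c k := funext fun ω => X.state_sub_filterRun _ c k ω
  rw [errorCov, herr, X.expectedCov_errorRun, crossMoment_errorRun hδ, sub_self,
    Matrix.zero_vecMulVec, add_zero]

theorem hasSteadyState_of_isStabilizing (hK : N.IsStabilizing K) (hS : 0 ≤ S)
    (hfix : N.covStep δ K S = S) : X.HasSteadyState K S := fun c => by
  simp only [predictorMSE_eq hδ]
  exact hK.tendsto_covStep hS (add_nonneg X.initialCov_nonneg (vecMulVec_nonneg _)) hfix

namespace HasSteadyState

theorem tendsto_initialCov (h : X.HasSteadyState K S) :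
    Tendsto (fun t => (N.covStep δ K)^[t] X.initialCov) atTop (𝓝 S) := by
  simpa only [predictorMSE_eq hδ, sub_self, Matrix.zero_vecMulVec, add_zero]
    using h X.initialMean

-- Two initial estimates whose difference is `x` have mean squared errors differing by `propagate K`
-- iterated on `x xᵀ`, and these rank one matrices span the cone of nonnegative matrices.
theorem isStabilizing (h : X.HasSteadyState K S) : N.IsStabilizing K := by
  have hrank1 (x : Fin n → ℝ) :
      Tendsto (fun t => (N.propagate K ^ t) (vecMulVec x x)) atTop (𝓝 0) := by
    have hdiff := (h (X.initialMean - x)).sub (h.tendsto_initialCov hδ)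
    simpa only [predictorMSE_eq hδ, sub_sub_cancel, N.covStep_iterate_sub, add_sub_cancel_left,
      sub_self] using hdiff
  intro M hM
  obtain ⟨x, rfl⟩ := exists_eq_sum_vecMulVec hM
  simpa only [map_sum, Finset.sum_const_zero] using
    tendsto_finsetSum Finset.univ fun a _ => hrank1 (x a)

theorem nonneg (h : X.HasSteadyState K S) : 0 ≤ S :=
  ge_of_tendsto' (h.tendsto_initialCov hδ) fun t => by
    induction t with
    | zero => exact X.initialCov_nonneg
    | succ t ih =>
      rw [Function.iterate_succ_apply']
      exact N.covStep_nonneg hδ ih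

theorem covStep_eq (h : X.HasSteadyState K S) : N.covStep δ K S = S :=
  isFixedPt_of_tendsto_iterate (h.tendsto_initialCov hδ)
    (tendsto_covStep tendsto_const_nhds tendsto_id)

theorem tendsto_errorCov (hsorted : Monotone (N.totalDelay δ)) (h : X.HasSteadyState G.steady S)
    (c : Fin n → ℝ) :
    Tendsto (fun k => X.errorCov G c k) atTop (𝓝 (N.gainPredictedCov δ G S)) := by
  rw [← tendsto_add_atTop_iff_nat (N.maxDelay δ - 1 + N.fusionDelay δ)]
  simp only [errorCov_eq hδ, covRun_gainSchedule hsorted hδ _ rfl]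
  exact (continuous_gainPredictedCov.tendsto S).comp (h.tendsto_initialCov hδ)

end HasSteadyState

variable (hsorted : Monotone (N.totalDelay δ)) (hP : P.PosDef)
  (hfix : N.kfStep δ (N.maxDelay δ) P = P)

include hsorted hP hfix

theorem hasSteadyState_kalmanGains (hK : N.IsStabilizing K) :
    X.HasSteadyState (N.kalmanGains δ P).steady P := by
  rw [kalmanGains_steady hsorted]
  exact hasSteadyState_of_isStabilizing hδ (N.isStabilizing_activeKalmanGain hδ hP hfix
    (fun i hi => absurd (mem_activeSensors_maxDelay hsorted i) hi) hK) hP.posSemidef.nonneg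
    ((N.covStep_activeKalmanGain hδ hP).trans hfix)

theorem HasSteadyState.predictedCov_le_gainPredictedCov (h : X.HasSteadyState G.steady S) :
    N.predictedCov δ P ≤ N.gainPredictedCov δ G S := by
  have hle : P ≤ N.covStep δ G.steady P := hfix.symm.trans_le (N.kfStep_le_covStep hδ hP
    fun i hi => absurd (mem_activeSensors_maxDelay hsorted i) hi)
  have hlim := (h.isStabilizing hδ).tendsto_covStep (h.nonneg hδ) hP.posSemidef.nonneg
    (h.covStep_eq hδ)
  exact ProcessingNetwork.predictedCov_le_gainPredictedCov hδ hP hfix hsorted G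
    (N.le_of_tendsto_covStep hle hlim)

end SteadyState

end Realization

end ProcessingNetwork

theorem theorem2 {n s : ℕ} {m : Fin (s + 1) → ℕ} (N : ProcessingNetwork n s m)
    (δ : Fin (s + 1) → ℕ) (hδ : ∀ i, 0 < δ i) (hsorted : Monotone (N.totalDelay δ))
    {Ω : Type*} [MeasurableSpace Ω] (μ : Measure Ω) [IsProbabilityMeasure μ]
    (X : N.Realization δ μ)
    (hsteady : ∃ K S, X.HasSteadyState K S) :
    (N.IsControllable → ∃ P, N.IsARESolution δ P) ∧
    ∀ P, N.IsARESolution δ P →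
      (∀ P', N.IsARESolution δ P' → P' = P) ∧
      X.HasSteadyState (N.kalmanGains δ P).steady P ∧
      ∀ xh0 : Fin n → ℝ,
        Tendsto (fun k => X.errorCov (N.kalmanGains δ P) xh0 k) atTop (𝓝 (N.predictedCov δ P)) ∧
        Tendsto (fun k => (X.errorCov (N.kalmanGains δ P) xh0 k).trace) atTop
          (𝓝 (N.predictedCov δ P).trace) ∧
        ∀ (G : ConstantGains n s m) (S : Matrix (Fin n) (Fin n) ℝ),
          (∃ S₀, X.HasSteadyState G.steady S₀) →
          Tendsto (fun k => X.errorCov G xh0 k) atTop (𝓝 S) →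
          (S - N.predictedCov δ P).PosSemidef := by
  obtain ⟨K, S, hKS⟩ := hsteady
  have hK := hKS.isStabilizing hδ
  refine ⟨fun hc => ?_, fun P ⟨hP, hfix⟩ => ?_⟩
  · obtain ⟨P, hP, hfix⟩ := hc.exists_kfStep_fixed (d := N.maxDelay δ) hδ
      (fun i hi => absurd (ProcessingNetwork.mem_activeSensors_maxDelay hsorted i) hi)
      (hKS.nonneg hδ) (hKS.covStep_eq hδ)
    exact ⟨P, hP, hfix.symm⟩
  have hP_steady : X.HasSteadyState (N.kalmanGains δ P).steady P :=
    ProcessingNetwork.Realization.hasSteadyState_kalmanGains hδ hsorted hP hfix.symm hK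
  have hlim (xh0) : Tendsto (fun k => X.errorCov (N.kalmanGains δ P) xh0 k) atTop
      (𝓝 (N.predictedCov δ P)) := by
    rw [← ProcessingNetwork.gainPredictedCov_kalmanGains hδ hP hfix.symm hsorted]
    exact hP_steady.tendsto_errorCov hδ hsorted xh0
  refine ⟨fun P' ⟨hP', hfix'⟩ => ?_, hP_steady, fun xh0 => ⟨hlim xh0, ?_, ?_⟩⟩
  · exact N.kfStep_fixed_unique hδ hP' hfix'.symm hP hfix.symm
      (fun i hi => absurd (ProcessingNetwork.mem_activeSensors_maxDelay hsorted i) hi) hK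
  · exact ((continuous_id.matrix_trace).tendsto _).comp (hlim xh0)
  · rintro G S' ⟨S₀, hS₀⟩ hS'
    rw [tendsto_nhds_unique hS' (hS₀.tendsto_errorCov hδ hsorted xh0)]
    exact Matrix.le_iff.1 (hS₀.predictedCov_le_gainPredictedCov hδ hsorted hP hfix.symm)
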